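/- **Setting.** Fix $d,m\in\mathbb N$. Let $H$ be a commutative Hopf algebra over $\mathbb R$ with coproduct $\Delta$ and unit $\mathbf 1$, and let $L_\alpha:H\to H$, $\alpha\in[d]=\{1,\dots,d\}$, be linear maps satisfying the cocycle condition $$\Delta L_\alpha(u)=(\mathrm{id}\otimes L_\alpha)\Delta(u)+L_\alpha(u)\otimes\mathbf 1\qquad(u\in H,\ \alpha\in[d]).$$ Let $H^*$ be the linear dual of $H$ with the product $\langle Z^1\star Z^2,h\rangle=\langle Z^1\otimes Z^2,\Delta h\rangle$. Let $\mathcal T$ be the set of (non-planar) rooted trees with vertices decorated by $[d]$, let $|\tau|$ be the number of vertices of $\tau$, and let $H_{BCK}$ be the linear span of the forests (finite multisets of trees) with the forest product $\odot$. Let $B_+^\alpha:H_{BCK}\to H_{BCK}$ be the linear map that joins all the roots of a forest to a new root decorated by $\alpha$. Let $\Lambda:H_{BCK}\to H$ be the unique morphism of algebras with $\Lambda\circ B_+^\alpha=L_\alpha\circ\Lambda$ for all $\alpha$, and let $\Lambda^*:H^*\to H_{BCK}^*$, $\langle\Lambda^*Z,x\rangle=\langle Z,\Lambda x\rangle$,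 be its dual map. For smooth vector fields $f_\alpha:\mathbb R^m\to\mathbb R^m$, $\alpha\in[d]$, the elementary differentials are given by $$\Upsilon_f\big[B_+^\alpha(\tau_1\odot\dots\odot\tau_n)\big](y)=D^nf_\alpha(y)\big(\Upsilon_f[\tau_1](y),\dots,\Upsilon_f[\tau_n](y)\big),$$ and the symmetry factors by $S(B_+^\alpha(\tau_1\odot\dots\odot\tau_n))=\prod_j r_j!\,S(\sigma_j)^{r_j}$, where $\sigma_1,\sigma_2,\dots$ are the distinct trees among $\tau_1,\dots,\tau_n$ and $r_j$ is the multiplicity of $\sigma_j$. The B-series are formal series, graded by the number of vertices: for $Z\in H_{BCK}^*$, $$B_{BCK}(y,Z)=y+\sum_{\tau\in\mathcal T}\varepsilon^{|\tau|}\,\frac{\langle Z,\tau\rangle}{S(\tau)}\,\Upsilon_f[\tau](y)\ \in\ \mathbb R^m[[\varepsilon]].$$ The same formula defines $B_{BCK}(Y,Z)$ for a formal point $Y=\sum_{n\ge0}\varepsilon^nY_n\in\mathbb R^m[[\varepsilon]]$ in place of $y$, a smooth map $g$ being evaluated at $Y$ by its Taylor series $g(Y)=\sum_{k\ge0}\frac1{k!}D^kg(Y_0)(Y-Y_0,\dots,Y-Y_0)$.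 For $Z\in H^*$ put $B_{T}(Y,Z):=B_{BCK}(Y,\Lambda^*Z)$. **Statement.** Let $Z^1\in H^*$ be a character, i.e. $\langle Z^1,\mathbf 1\rangle=1$ and $\langle Z^1,uv\rangle=\langle Z^1,u\rangle\langle Z^1,v\rangle$ for all $u,v\in H$, and let $Z^2\in H^*$ satisfy $\langle Z^2,\mathbf 1\rangle=1$. Then for every $y\in\mathbb R^m$, as formal power series in $\varepsilon$, $$B_{T}\big(B_{T}(y,Z^1),Z^2\big)=B_{T}\big(y,Z^1\star Z^2\big).$$ -/

import Mathlib

open scoped TensorProduct ContDiff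

/-- Rooted trees with vertices decorated by `[d]`, with an ordering of the children of each
vertex (planar representatives of rooted trees). -/
inductive PTree (d : ℕ) : Type
  | node (a : Fin d) (n : ℕ) (c : Fin n → PTree d) : PTree d

namespace PTree

variable {d : ℕ}

/-- Two planar trees represent the same (non-planar) decorated rooted tree: the decorations of the
roots agree and, up to a permutation, the subtrees at the roots represent the same trees. -/
inductive Iso : PTree d → PTree d → Prop
  | node (a : Fin d) (n : ℕ) (c c' : Fin n → PTree d) (s : Equiv.Perm (Fin n))
      (h : ∀ i, Iso (c i) (c' (s i))) : Iso (PTree.node a n c) (PTree.node a n c')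

theorem Iso.refl (t : PTree d) : Iso t t := by
  induction t with
  | node a n c ih => exact Iso.node a n c c 1 (fun i => ih i)

theorem Iso.symm {t t' : PTree d} (h : Iso t t') : Iso t' t := by
  induction h with
  | node a n c c' s _ ih =>
    refine Iso.node a n c' c s⁻¹ (fun i => ?_)
    have := ih (s⁻¹ i)
    simpa using this

theorem Iso.trans {t t' t'' : PTree d} (h : Iso t t') (h' : Iso t' t'') : Iso t t'' := by
  induction h generalizing t'' with
  | node a n c c' s _ ih =>
    cases h' with
    | node _ _ _ c'' s' h2 =>
      exact Iso.node a n c c'' (s' * s) (fun i => ih i (h2 (s i)))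

instance setoid (d : ℕ) : Setoid (PTree d) where
  r := Iso
  iseqv := ⟨Iso.refl, Iso.symm, Iso.trans⟩

/-- Number of vertices. -/
def size : PTree d → ℕ
  | node _ _ c => 1 + ∑ i, size (c i)

theorem Iso.size_eq {t t' : PTree d} (h : Iso t t') : t.size = t'.size := by
  induction h with
  | node a n c c' s _ ih =>
    simp only [size]
    rw [← Equiv.sum_comp s (fun i => (c' i).size)]
    simp only [ih]

theorem finite_size_le (n : ℕ) : {t : PTree d | t.size ≤ n}.Finite := by
  induction n with
  | zero =>
    refine Set.Finite.subset Set.finite_empty ?_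
    rintro ⟨a, k, c⟩ h
    simp [size] at h
  | succ n ih =>
    have key : (⋃ a : Fin d, ⋃ k ∈ Set.Iic n,
        (fun c : Fin k → PTree d => node a k c) ''
          (Set.pi Set.univ fun _ => {t : PTree d | t.size ≤ n})).Finite := by
      refine Set.finite_iUnion fun a => (Set.finite_Iic n).biUnion fun k _ => ?_
      exact (Set.Finite.pi fun _ => ih).image _
    refine key.subset ?_
    rintro ⟨a, k, c⟩ h
    have hs : ∑ i, (c i).size ≤ n := by
      simp only [Set.mem_ofPred_eq, size] at h; omega
    have hpos : ∀ t : PTree d, 1 ≤ t.size := by rintro ⟨_, _, _⟩; simp [size]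
    have hk : k ≤ n := by
      calc k = ∑ _i : Fin k, 1 := by simp
        _ ≤ ∑ i, (c i).size := Finset.sum_le_sum fun i _ => hpos _
        _ ≤ n := hs
    simp only [Set.mem_iUnion]
    refine ⟨a, k, hk, c, ?_, rfl⟩
    intro i _
    exact (Finset.single_le_sum (f := fun i => (c i).size) (fun _ _ => Nat.zero_le _)
      (Finset.mem_univ i)).trans hs

end PTree

/-- Non-planar rooted trees with vertices decorated by `[d]`. -/
def RTree (d : ℕ) : Type := Quotient (PTree.setoid d)

namespace RTree

variable {d : ℕ}

/-- The rooted tree represented by a planar tree. -/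
def mk (t : PTree d) : RTree d := Quotient.mk _ t

theorem mk_eq_mk {t t' : PTree d} : mk t = mk t' ↔ PTree.Iso t t' := Quotient.eq

/-- Number of vertices of a rooted tree. -/
def size : RTree d → ℕ := Quotient.lift PTree.size (fun _ _ h => PTree.Iso.size_eq h)

theorem finite_size_eq (n : ℕ) : {t : RTree d | t.size = n}.Finite := by
  refine ((PTree.finite_size_le (d := d) n).image mk).subset ?_
  intro t
  refine Quotient.inductionOn t fun p hp => ⟨p, ?_, rfl⟩
  exact le_of_eq hp

/-- The finite set of all rooted trees with exactly `n` vertices. -/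
noncomputable def ofSize (d n : ℕ) : Finset (RTree d) := (finite_size_eq (d := d) n).toFinset

/-- The tree obtained by joining all the roots of a forest (a multiset of rooted trees) to a new
root decorated by `a`. -/
noncomputable def graft (a : Fin d) (F : Multiset (RTree d)) : RTree d :=
  mk (PTree.node a F.toList.length fun i => Quotient.out (F.toList.get i))

end RTree

open Classical in
/-- Symmetry factor `S(B₊(τ₁ ⋯ τₙ)) = ∏ⱼ rⱼ! S(τⱼ)^rⱼ`; the product of the factorials runs over the
distinct isomorphism classes among `τ₁, …, τₙ`, where `rⱼ` is the size of the `j`-th class. -/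
noncomputable def PTree.symFactor {d : ℕ} : PTree d → ℕ
  | node _ _ c =>
    (∏ s ∈ Finset.univ.image (fun i => RTree.mk (c i)),
      (Finset.univ.filter fun i => RTree.mk (c i) = s).card.factorial) * ∏ i, symFactor (c i)

theorem PTree.Iso.symFactor_eq {d : ℕ} {t t' : PTree d} (h : PTree.Iso t t') :
    t.symFactor = t'.symFactor := by
  classical
  induction h with
  | node a n c c' s h ih =>
    have e : ∀ i, RTree.mk (c i) = RTree.mk (c' (s i)) := fun i => RTree.mk_eq_mk.2 (h i)
    simp only [PTree.symFactor]
    congr 1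
    · have himg : Finset.univ.image (fun i => RTree.mk (c i)) =
          Finset.univ.image (fun i => RTree.mk (c' i)) := by
        ext x
        simp only [Finset.mem_image, Finset.mem_univ, true_and, e]
        exact ⟨fun ⟨i, hi⟩ => ⟨s i, hi⟩, fun ⟨i, hi⟩ => ⟨s.symm i, by simpa using hi⟩⟩
      rw [himg]
      refine Finset.prod_congr rfl fun x _ => ?_
      congr 1
      refine Finset.card_bij (fun i _ => s i) ?_ ?_ ?_
      · intro i hi
        simpa [e] using hi
      · intro i _ j _ hij
        exact s.injective hij
      · intro j hj
        exact ⟨s.symm j, by simpa [e] using hj, by simp⟩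
    · rw [← Equiv.prod_comp s (fun i => (c' i).symFactor)]
      exact Finset.prod_congr rfl fun i _ => ih i

/-- Symmetry factor of a rooted tree. -/
noncomputable def RTree.symFactor {d : ℕ} : RTree d → ℕ :=
  Quotient.lift PTree.symFactor (fun _ _ h => PTree.Iso.symFactor_eq h)

/-- The Butcher-Connes-Kreimer algebra: the linear span of the forests (finite multisets of rooted
trees, i.e. commutative monomials in rooted trees) with the forest product. -/
abbrev HBCK (d : ℕ) : Type := MvPolynomial (RTree d) ℝ

/-- The linear map `B₊^a` on the span of forests. -/
noncomputable def Bplus {d : ℕ} (a : Fin d) : HBCK d →ₗ[ℝ] HBCK d :=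
  (MvPolynomial.basisMonomials (RTree d) ℝ).constr ℝ
    (fun F => MvPolynomial.X (RTree.graft a (Finsupp.toMultiset F)))

section Hopf

variable {d : ℕ} {H : Type*} [CommRing H] [HopfAlgebra ℝ H]

/-- The cocycle condition `Δ L_a(u) = (id ⊗ L_a) Δ(u) + L_a(u) ⊗ 1`, for all `a ∈ [d]`. -/
def IsCocycle (L : Fin d → H →ₗ[ℝ] H) : Prop :=
  ∀ a u, Coalgebra.comul (R := ℝ) (L a u) =
    TensorProduct.map LinearMap.id (L a) (Coalgebra.comul (R := ℝ) u) + L a u ⊗ₜ[ℝ] (1 : H)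

/-- The product on `H*` dual to the coproduct: `⟨Z₁ ⋆ Z₂, h⟩ = ⟨Z₁ ⊗ Z₂, Δ h⟩`. -/
noncomputable def dualStar (Z₁ Z₂ : Module.Dual ℝ H) : Module.Dual ℝ H :=
  LinearMap.mul' ℝ ℝ ∘ₗ TensorProduct.map Z₁ Z₂ ∘ₗ Coalgebra.comul

/-- Characters: the elements of `H*` that are unital and multiplicative. -/
def IsCharacter (Z : Module.Dual ℝ H) : Prop :=
  Z 1 = 1 ∧ ∀ u v, Z (u * v) = Z u * Z v

/-- `Λ` on planar trees: `Λ(B₊^a(τ₁ ⋯ τₙ)) = L_a(Λ(τ₁) ⋯ Λ(τₙ))`. -/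
noncomputable def PTree.toHopf (L : Fin d → H →ₗ[ℝ] H) : PTree d → H
  | node a _ c => L a (∏ i, PTree.toHopf L (c i))

theorem PTree.Iso.toHopf_eq (L : Fin d → H →ₗ[ℝ] H) {t t' : PTree d} (h : PTree.Iso t t') :
    t.toHopf L = t'.toHopf L := by
  induction h with
  | node a n c c' s _ ih =>
    simp only [PTree.toHopf]
    rw [← Equiv.prod_comp s (fun i => (c' i).toHopf L)]
    simp only [ih]

/-- `Λ` on rooted trees. -/
noncomputable def RTree.toHopf (L : Fin d → H →ₗ[ℝ] H) : RTree d → H :=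
  Quotient.lift (PTree.toHopf L) (fun _ _ h => PTree.Iso.toHopf_eq L h)

/-- The canonical morphism `Λ : H_BCK → H`. It is the unique morphism of algebras with
`Λ ∘ B₊^a = L_a ∘ Λ` for all `a`, see `Lam_Bplus` and `Lam_unique`. -/
noncomputable def Lam (L : Fin d → H →ₗ[ℝ] H) : HBCK d →ₐ[ℝ] H :=
  MvPolynomial.aeval (RTree.toHopf L)

theorem RTree.toHopf_graft (L : Fin d → H →ₗ[ℝ] H) (a : Fin d) (F : Multiset (RTree d)) :
    (RTree.graft a F).toHopf L = L a ((F.map (RTree.toHopf L)).prod) := by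
  have h1 : ∀ t : RTree d, PTree.toHopf L (Quotient.out t) = t.toHopf L := by
    intro t
    conv_rhs => rw [← Quotient.out_eq t]
    rfl
  change L a (∏ i, PTree.toHopf L (Quotient.out (F.toList.get i))) = _
  congr 1
  simp only [h1]
  conv_rhs => rw [← Multiset.coe_toList F]
  rw [Multiset.map_coe, Multiset.prod_coe, ← List.prod_ofFn]
  congr 1
  conv_rhs => rw [← List.ofFn_get F.toList]
  rw [List.map_ofFn]
  rfl

theorem Lam_Bplus (L : Fin d → H →ₗ[ℝ] H) (a : Fin d) (x : HBCK d) :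
    Lam L (Bplus a x) = L a (Lam L x) := by
  have : (Lam L).toLinearMap ∘ₗ Bplus a = L a ∘ₗ (Lam L).toLinearMap := by
    refine (MvPolynomial.basisMonomials (RTree d) ℝ).ext fun F => ?_
    rw [LinearMap.comp_apply, LinearMap.comp_apply, Bplus, Module.Basis.constr_basis]
    simp only [AlgHom.toLinearMap_apply, Lam, MvPolynomial.aeval_X, RTree.toHopf_graft,
      MvPolynomial.coe_basisMonomials, MvPolynomial.aeval_monomial, map_one, one_mul]
    congr 1
    rw [Finsupp.toMultiset_map, Finsupp.prod_toMultiset,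
      Finsupp.prod_mapDomain_index (by simp) (by intros; rw [pow_add])]
  exact LinearMap.congr_fun this x

theorem exists_perm_of_card_fiber {α : Type*} [DecidableEq α] {n : ℕ} (u v : Fin n → α)
    (h : Finset.univ.val.map u = Finset.univ.val.map v) :
    ∃ s : Equiv.Perm (Fin n), ∀ i, u i = v (s i) := by
  have hc : ∀ x, Nonempty ({i // u i = x} ≃ {i // v i = x}) := by
    intro x
    refine Fintype.card_eq.1 ?_
    have := congrArg (Multiset.count x) h
    rw [Multiset.count_map, Multiset.count_map] at this
    rw [Fintype.card_subtype, Fintype.card_subtype, Finset.card_def, Finset.card_def,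
      Finset.filter_val, Finset.filter_val]
    simpa only [eq_comm] using this
  exact ⟨Equiv.ofFiberEquiv fun x => (hc x).some, fun i => (Equiv.ofFiberEquiv_map _ i).symm⟩

theorem RTree.graft_map_mk (a : Fin d) (n : ℕ) (c : Fin n → PTree d) :
    RTree.graft a (Finset.univ.val.map fun i => RTree.mk (c i)) =
      RTree.mk (PTree.node a n c) := by
  classical
  set F : Multiset (RTree d) := Finset.univ.val.map fun i => RTree.mk (c i) with hF
  have hlen : F.toList.length = n := by simp [hF]
  have hp : (F.toList : Multiset (RTree d)) = Finset.univ.val.map fun i => RTree.mk (c i) := by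
    rw [Multiset.coe_toList, hF]
  unfold RTree.graft
  generalize F.toList = l at hp hlen
  subst hlen
  refine RTree.mk_eq_mk.2 ?_
  have hp' : (Finset.univ.val.map fun i => RTree.mk (Quotient.out (l.get i))) =
      Finset.univ.val.map fun i => RTree.mk (c i) := by
    rw [← hp]
    have : ∀ t : RTree d, RTree.mk (Quotient.out t) = t := fun t => Quotient.out_eq t
    simp only [this, Fin.univ_val_map, List.ofFn_get]
  obtain ⟨s, hs⟩ := exists_perm_of_card_fiber _ _ hp'
  exact PTree.Iso.node a _ _ _ s fun i => RTree.mk_eq_mk.1 (hs i)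

theorem Lam_unique (L : Fin d → H →ₗ[ℝ] H) (Φ : HBCK d →ₐ[ℝ] H)
    (hΦ : ∀ a x, Φ (Bplus a x) = L a (Φ x)) : Φ = Lam L := by
  refine MvPolynomial.algHom_ext fun t => ?_
  refine Quotient.inductionOn t fun p => ?_
  change Φ (MvPolynomial.X (RTree.mk p)) = Lam L (MvPolynomial.X (RTree.mk p))
  induction p with
  | node a n c ih =>
    have key : (MvPolynomial.X (RTree.mk (PTree.node a n c)) : HBCK d) =
        Bplus a (∏ i, MvPolynomial.X (RTree.mk (c i))) := by
      have h1 : (∏ i, MvPolynomial.X (RTree.mk (c i)) : HBCK d) =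
          MvPolynomial.basisMonomials (RTree d) ℝ
            (∑ i, Finsupp.single (RTree.mk (c i)) 1) := by
        rw [MvPolynomial.coe_basisMonomials]
        exact (MvPolynomial.monomial_sum_one _ _).symm
      have h2 : Finsupp.toMultiset (∑ i, Finsupp.single (RTree.mk (c i)) 1) =
          Finset.univ.val.map fun i => RTree.mk (c i) := by
        rw [Finsupp.toMultiset_sum]
        simp only [Finsupp.toMultiset_single, one_nsmul]
        have := Multiset.sum_map_singleton (Finset.univ.val.map fun i => RTree.mk (c i))
        rwa [Multiset.map_map] at this
      rw [h1, Bplus, Module.Basis.constr_basis, h2, RTree.graft_map_mk]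
    rw [key, hΦ, Lam_Bplus, map_prod Φ, map_prod (Lam L)]
    simp only [ih]

/-- The dual map `Λ* : H* → H_BCK*`, `⟨Λ* Z, x⟩ = ⟨Z, Λ x⟩`. -/
noncomputable def LamStar (L : Fin d → H →ₗ[ℝ] H) (Z : Module.Dual ℝ H) :
    Module.Dual ℝ (HBCK d) :=
  Z ∘ₗ (Lam L).toLinearMap

end Hopf

section BSeries

variable {d m : ℕ}

/-- Elementary differentials of planar trees, `Υ_f[B₊^a(τ₁ ⋯ τₙ)](y)
= ∑_{b ∈ [m]ⁿ} (∂_{b₁} ⋯ ∂_{bₙ} f_a)(y) ∏ᵢ Υ_f^{bᵢ}[τᵢ](y)`, that is,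
the `n`-th derivative of `f_a` at `y` in the directions `Υ_f[τ₁](y), …, Υ_f[τₙ](y)`. -/
noncomputable def PTree.elemDiff
    (f : Fin d → EuclideanSpace ℝ (Fin m) → EuclideanSpace ℝ (Fin m)) :
    PTree d → EuclideanSpace ℝ (Fin m) → EuclideanSpace ℝ (Fin m)
  | node a n c => fun y => iteratedFDeriv ℝ n (f a) y fun i => PTree.elemDiff f (c i) y

theorem iteratedFDeriv_comp_swap {E F : Type*} [NormedAddCommGroup E] [NormedSpace ℝ E]
    [NormedAddCommGroup F] [NormedSpace ℝ F] {g : E → F} (hg : ContDiff ℝ ∞ g) (n : ℕ)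
    (i : Fin n) (y : E) (v : Fin (n + 1) → E) :
    iteratedFDeriv ℝ (n + 1) g y (v ∘ Equiv.swap i.castSucc i.succ) =
      iteratedFDeriv ℝ (n + 1) g y v := by
  induction n generalizing y with
  | zero => exact i.elim0
  | succ k ih =>
    refine Fin.cases ?_ (fun j => ?_) i
    · have hG : ContDiff ℝ ∞ (iteratedFDeriv ℝ k g) :=
        hg.iteratedFDeriv_right (m := ∞) (by exact_mod_cast le_top)
      have hsym : IsSymmSndFDerivAt ℝ (iteratedFDeriv ℝ k g) y :=
        hG.contDiffAt.isSymmSndFDerivAt (by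
          simp only [minSmoothness_of_isRCLikeNormedField]
          exact (mod_cast le_top : (((2 : ℕ) : ℕ∞) : WithTop ℕ∞) ≤ ∞))
      have key : ∀ w : Fin (k + 2) → E, iteratedFDeriv ℝ (k + 2) g y w =
          fderiv ℝ (fderiv ℝ (iteratedFDeriv ℝ k g)) y (w 0) (w 1) (Fin.tail (Fin.tail w)) := by
        intro w
        have hd1 : Differentiable ℝ (iteratedFDeriv ℝ (k + 1) g) :=
          (hg.iteratedFDeriv_right (m := ∞) (by exact_mod_cast le_top)).differentiable (by simp)
        have hd2 : Differentiable ℝ (fderiv ℝ (iteratedFDeriv ℝ k g)) :=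
          (hG.fderiv_right (m := ∞) (by exact_mod_cast le_top)).differentiable (by simp)
        rw [iteratedFDeriv_succ_apply_left,
          ← fderiv_continuousMultilinear_apply_const_apply hd1.differentiableAt]
        simp only [iteratedFDeriv_succ_apply_left]
        rw [fderiv_continuousMultilinear_apply_const_apply
            (hd2.differentiableAt.clm_apply (differentiableAt_const _)),
          fderiv_clm_apply hd2.differentiableAt (differentiableAt_const _)]
        simp
        rfl
      rw [key, key]
      have h0 : (v ∘ Equiv.swap (Fin.castSucc (0 : Fin (k + 1))) (Fin.succ 0)) 0 = v 1 := by
        simp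
      have h1 : (v ∘ Equiv.swap (Fin.castSucc (0 : Fin (k + 1))) (Fin.succ 0)) 1 = v 0 := by
        simp
      have h2 : Fin.tail (Fin.tail (v ∘ Equiv.swap (Fin.castSucc (0 : Fin (k + 1)))
          (Fin.succ 0))) = Fin.tail (Fin.tail v) := by
        funext l
        simp only [Fin.tail, Function.comp]
        rw [Equiv.swap_apply_of_ne_of_ne] <;> simp [Fin.ext_iff]
      rw [h0, h1, h2, hsym.eq]
    · have hd : Differentiable ℝ (iteratedFDeriv ℝ (k + 1) g) :=
        (hg.iteratedFDeriv_right (m := ∞) (by exact_mod_cast le_top)).differentiable (by simp)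
      rw [iteratedFDeriv_succ_apply_left, iteratedFDeriv_succ_apply_left]
      have h0 : (v ∘ Equiv.swap j.succ.castSucc j.succ.succ) 0 = v 0 := by
        simp only [Function.comp]
        rw [Equiv.swap_apply_of_ne_of_ne] <;> simp [Fin.ext_iff]
      have h1 : Fin.tail (v ∘ Equiv.swap j.succ.castSucc j.succ.succ) =
          Fin.tail v ∘ Equiv.swap j.castSucc j.succ := by
        funext l
        simp only [Fin.tail, Function.comp]
        rw [← Fin.succ_castSucc, (Fin.succ_injective _).swap_apply]
      rw [h0, h1, ← fderiv_continuousMultilinear_apply_const_apply hd.differentiableAt,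
        ← fderiv_continuousMultilinear_apply_const_apply hd.differentiableAt]
      simp only [ih]

theorem iteratedFDeriv_comp_perm_of_smooth {E F : Type*} [NormedAddCommGroup E]
    [NormedSpace ℝ E] [NormedAddCommGroup F] [NormedSpace ℝ F] {g : E → F}
    (hg : ContDiff ℝ ∞ g) (n : ℕ) (y : E) (v : Fin n → E) (s : Equiv.Perm (Fin n)) :
    iteratedFDeriv ℝ n g y (v ∘ s) = iteratedFDeriv ℝ n g y v := by
  cases n with
  | zero => congr 1; exact Subsingleton.elim _ _
  | succ n =>
    have hs : s ∈ Submonoid.closure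
        (Set.range fun i : Fin n => Equiv.swap i.castSucc i.succ) := by
      rw [Equiv.Perm.mclosure_swap_castSucc_succ]; trivial
    induction hs using Submonoid.closure_induction generalizing v with
    | mem x hx =>
      obtain ⟨i, rfl⟩ := hx
      exact iteratedFDeriv_comp_swap hg n i y v
    | one => rfl
    | mul s t _ _ h1 h2 =>
      rw [Equiv.Perm.coe_mul, ← Function.comp_assoc, h2, h1]

theorem PTree.Iso.elemDiff_eq
    (f : Fin d → EuclideanSpace ℝ (Fin m) → EuclideanSpace ℝ (Fin m))
    (hf : ∀ a, ContDiff ℝ ∞ (f a)) {t t' : PTree d} (h : PTree.Iso t t') :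
    t.elemDiff f = t'.elemDiff f := by
  induction h with
  | node a n c c' s _ ih =>
    funext y
    simp only [PTree.elemDiff, ih]
    exact iteratedFDeriv_comp_perm_of_smooth (hf a) n y (fun i => (c' i).elemDiff f y) s

/-- Elementary differentials of rooted trees, for smooth vector fields `f_a` on `ℝ^m`. -/
noncomputable def RTree.elemDiff
    (f : Fin d → EuclideanSpace ℝ (Fin m) → EuclideanSpace ℝ (Fin m))
    (hf : ∀ a, ContDiff ℝ ∞ (f a)) :
    RTree d → EuclideanSpace ℝ (Fin m) → EuclideanSpace ℝ (Fin m) :=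
  Quotient.lift (PTree.elemDiff f) (fun _ _ h => PTree.Iso.elemDiff_eq f hf h)

/-- Formal points of `ℝ^m`: formal power series `Y₀ + Y₁ ε + Y₂ ε² + ⋯` with coefficients in `ℝ^m`,
given by the sequence of their coefficients. -/
abbrev FormalPoint (m : ℕ) : Type := ℕ → EuclideanSpace ℝ (Fin m)

/-- A point of `ℝ^m` as a constant formal power series. -/
def FormalPoint.const (y : EuclideanSpace ℝ (Fin m)) : FormalPoint m :=
  fun N => if N = 0 then y else 0

/-- The value `g(Y)` of a smooth map `g` at a formal point `Y`, given by the Taylor series of `g` at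
`Y₀`: `g(Y) = ∑ₖ (1/k!) Dᵏg(Y₀)(Y - Y₀, …, Y - Y₀)`. By multilinearity the coefficient of `ε^N` is the
sum over all `k` and all `n₁, …, nₖ ≥ 1` with `n₁ + ⋯ + nₖ = N` of
`(1/k!) Dᵏg(Y₀)(Y_{n₁}, …, Y_{nₖ})`. -/
noncomputable def evalFormal (g : EuclideanSpace ℝ (Fin m) → EuclideanSpace ℝ (Fin m))
    (Y : FormalPoint m) : FormalPoint m := fun N =>
  ∑ c : Composition N, ((c.length.factorial : ℝ)⁻¹) •
    iteratedFDeriv ℝ c.length g (Y 0) fun i => Y (c.blocksFun i)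

/-- The B-series over rooted trees, graded by the number of vertices:
`B(Y, Z) = Y + ∑_τ ε^|τ| (⟨Z, τ⟩ / S(τ)) Υ_f[τ](Y)`, as a formal power series in `ε`. -/
noncomputable def bSeriesTree
    (f : Fin d → EuclideanSpace ℝ (Fin m) → EuclideanSpace ℝ (Fin m))
    (hf : ∀ a, ContDiff ℝ ∞ (f a)) (Y : FormalPoint m) (Z : Module.Dual ℝ (HBCK d)) :
    FormalPoint m := fun N =>
  Y N + ∑ p ∈ Finset.HasAntidiagonal.antidiagonal N, ∑ t ∈ RTree.ofSize d p.1,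
    (Z (MvPolynomial.X t) / (t.symFactor : ℝ)) • evalFormal (t.elemDiff f hf) Y p.2

/-- The B-series attached to `H` and its cocycles: `B_H(Y, Z) = B(Y, Λ* Z)`. -/
noncomputable def bSeriesHopf {H : Type*} [CommRing H] [HopfAlgebra ℝ H]
    (L : Fin d → H →ₗ[ℝ] H)
    (f : Fin d → EuclideanSpace ℝ (Fin m) → EuclideanSpace ℝ (Fin m))
    (hf : ∀ a, ContDiff ℝ ∞ (f a)) (Y : FormalPoint m) (Z : Module.Dual ℝ H) : FormalPoint m :=
  bSeriesTree f hf Y (LamStar L Z)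

end BSeries

/-! The B-series is a linear image of one universal series. For a formal point `Y`, let `P` be `Y`
plus the sum over planar trees `p` of `ε^|p| w(p) Λ(p) Υ[p](Y)`, with coefficients in `H`. Applying
a functional `Z` with `Z 1 = 1` to `P` gives `B_T(Y, Z)`, because the weights `w` of the planar
representatives of a rooted tree `τ` add up to `1 / S(τ)` (`PTree.sum_weight_fiber`,
`bSeriesHopf_apply`).

Taylor expansion of `f_a` at `Y` and grafting of trees show that `P` solves `P = Y + ε ∑ₐ
L_a(f_a(P))` (`coeff_succ_treeSeries`), and this equation determines `P` order by order
(`coeff_eq_of_fixedPoint`).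

For a character `Z₁`, the map `φ = (Z₁ ⊗ id) Δ` is a morphism of algebras, hence commutes with
evaluation of smooth functions at formal points, and the cocycle condition becomes `φ L_a = L_a φ +
Z₁(L_a ·) 1`. Applying `φ` to the fixed point equation of `P` yields `φ(P) = Y' + ε ∑ₐ
L_a(f_a(φ(P)))` with `Y' = B_T(Y, Z₁)`. By uniqueness `φ(P)` is the universal series based at `Y'`
(`map_coeff_treeSeries`). Since `Z₂ ∘ φ = Z₁ ⋆ Z₂`, applying `Z₂` gives the theorem.

Evaluation at a formal point over an `ℝ`-algebra is characterised by the chain rule, a linear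
differential system with unique solutions; its algebraic properties all follow from that uniqueness.
Tree sums are cut at `K` vertices, which is exact up to order `K`. -/

/-! ### Evaluation at formal points through the chain rule -/

section FormalEvaluation

open PowerSeries

/-- Uniqueness, up to order `K`, of the solutions of the linear system of differential equations
`d/dε (F t) = ∑_c F (δ_c t) q_c` in power series with given constant coefficients. -/
theorem PowerSeries.coeff_eq_of_derivative_system {A : Type*} [CommRing A] [Algebra ℝ A]
    {T κ : Type*} [Fintype κ] (δ : κ → T → T) {q q' : κ → A⟦X⟧} {F G : T → A⟦X⟧} (K : ℕ)
    (h0 : ∀ t, coeff 0 (F t) = coeff 0 (G t))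
    (hF : ∀ k < K, ∀ t, coeff k (d⁄dX A (F t)) = coeff k (∑ c, F (δ c t) * q c))
    (hG : ∀ k < K, ∀ t, coeff k (d⁄dX A (G t)) = coeff k (∑ c, G (δ c t) * q' c))
    (hq : ∀ k < K, ∀ c, coeff k (q c) = coeff k (q' c)) :
    ∀ k ≤ K, ∀ t, coeff k (F t) = coeff k (G t) := by
  intro k
  induction k using Nat.strong_induction_on with
  | _ k ih =>
    intro hk t
    cases k with
    | zero => exact h0 t
    | succ k =>
      -- The derivative at order `k` involves `F` and `q` only at orders up to `k`; dividing by `k +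
      -- 1`, invertible in an `ℝ`-algebra, recovers order `k + 1`.
      have h : coeff k (d⁄dX A (F t)) = coeff k (d⁄dX A (G t)) := by
        rw [hF k hk, hG k hk, map_sum, map_sum]
        refine Finset.sum_congr rfl fun c _ => ?_
        rw [coeff_mul, coeff_mul]
        refine Finset.sum_congr rfl fun p hp => ?_
        have := Finset.HasAntidiagonal.mem_antidiagonal.1 hp
        rw [ih p.1 (by omega) (by omega), hq p.2 (by omega)]
      rw [coeff_derivative, coeff_derivative] at h
      have hu : ((k : ℝ) + 1) ≠ 0 := by positivity
      have h' := congrArg (fun a => ((k : ℝ) + 1)⁻¹ • a) h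
      have e : ((k : A) + 1) = algebraMap ℝ A ((k : ℝ) + 1) := by simp
      simpa only [e, mul_comm _ (algebraMap ℝ A _), ← Algebra.smul_def, inv_smul_smul₀ hu] using h'

theorem PowerSeries.eq_of_derivative_system {A : Type*} [CommRing A] [Algebra ℝ A]
    {T κ : Type*} [Fintype κ] (δ : κ → T → T) {q : κ → A⟦X⟧} {F G : T → A⟦X⟧}
    (h0 : ∀ t, coeff 0 (F t) = coeff 0 (G t))
    (hF : ∀ t, d⁄dX A (F t) = ∑ c, F (δ c t) * q c)
    (hG : ∀ t, d⁄dX A (G t) = ∑ c, G (δ c t) * q c) (t : T) : F t = G t := by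
  ext k
  exact coeff_eq_of_derivative_system δ (q := q) (q' := q) k h0 (fun _ _ t => by rw [hF])
    (fun _ _ t => by rw [hG]) (fun _ _ _ => rfl) k le_rfl t

variable {ι : Type*} [Fintype ι] {S : Type*} [CommRing S] [Algebra ℝ S]
  (D : ι → Derivation ℝ S S) (e : S →ₐ[ℝ] ℝ)
  {A : Type*} [CommRing A] [Algebra ℝ A] {B : Type*} [CommRing B] [Algebra ℝ B]

/-- The coefficients of `formalEval`. -/
noncomputable def formalEvalCoeff (P : ι → A⟦X⟧) : ℕ → S → A
  -- The constant coefficient of `P` never enters: the base point is carried by `e` alone.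
  | 0, g => algebraMap ℝ A (e g)
  | k + 1, g => ((k : ℝ) + 1)⁻¹ • ∑ i, ∑ j : Fin (k + 1),
      formalEvalCoeff P j (D i g) * coeff (k - j) (d⁄dX A (P i))
  termination_by k => k

/-- The evaluation of a "function" `g` at a formal point `P`, determined by its constant coefficient
`e g` and the chain rule `d/dε g(P) = ∑ᵢ (∂ᵢ g)(P) dPᵢ/dε`. -/
noncomputable def formalEvalFun (P : ι → A⟦X⟧) (g : S) : A⟦X⟧ :=
  PowerSeries.mk fun k => formalEvalCoeff D e P k g

theorem coeff_zero_formalEvalFun (P : ι → A⟦X⟧) (g : S) :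
    coeff 0 (formalEvalFun D e P g) = algebraMap ℝ A (e g) := by
  rw [formalEvalFun, coeff_mk, formalEvalCoeff]

theorem derivative_formalEvalFun (P : ι → A⟦X⟧) (g : S) :
    d⁄dX A (formalEvalFun D e P g) = ∑ i, formalEvalFun D e P (D i g) * d⁄dX A (P i) := by
  ext k
  have hu : ((k : ℝ) + 1) ≠ 0 := by positivity
  have e' : ((k : A) + 1) = algebraMap ℝ A ((k : ℝ) + 1) := by simp
  rw [coeff_derivative, formalEvalFun, coeff_mk, formalEvalCoeff, e', mul_comm,
    ← Algebra.smul_def, smul_inv_smul₀ hu, map_sum]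
  refine Finset.sum_congr rfl fun i _ => ?_
  rw [coeff_mul, Finset.Nat.sum_antidiagonal_eq_sum_range_succ
    (fun a b => coeff a (formalEvalFun D e P (D i g)) * coeff b (d⁄dX A (P i))),
    Finset.sum_range]
  simp only [formalEvalFun, coeff_mk]

/-- Both sides, as families indexed by pairs `(g, h)`, solve the same differential system, each
derivation acting on both entries. -/
theorem formalEvalFun_add (P : ι → A⟦X⟧) (g h : S) :
    formalEvalFun D e P (g + h) = formalEvalFun D e P g + formalEvalFun D e P h := by
  refine eq_of_derivative_system (T := S × S) (fun i t => (D i t.1, D i t.2))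
    (q := fun i => d⁄dX A (P i)) (F := fun t => formalEvalFun D e P (t.1 + t.2))
    (G := fun t => formalEvalFun D e P t.1 + formalEvalFun D e P t.2) ?_ ?_ ?_ (g, h)
  · intro t
    simp only [map_add, coeff_zero_formalEvalFun]
  · intro t
    simp only [derivative_formalEvalFun, map_add]
  · intro t
    simp only [derivative_formalEvalFun, map_add, add_mul, Finset.sum_add_distrib]

theorem formalEvalFun_zero (P : ι → A⟦X⟧) : formalEvalFun D e P 0 = 0 := by
  simpa using formalEvalFun_add D e P 0 0

/-- Leibniz rule on both sides: the system has one direction for each derivation and each choice of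
the factor it differentiates, whence the index `ι × Bool`. -/
theorem formalEvalFun_mul (P : ι → A⟦X⟧) (g h : S) :
    formalEvalFun D e P (g * h) = formalEvalFun D e P g * formalEvalFun D e P h := by
  refine eq_of_derivative_system (T := S × S) (κ := ι × Bool)
    (fun i t => if i.2 then (D i.1 t.1, t.2) else (t.1, D i.1 t.2))
    (q := fun i => d⁄dX A (P i.1)) (F := fun t => formalEvalFun D e P (t.1 * t.2))
    (G := fun t => formalEvalFun D e P t.1 * formalEvalFun D e P t.2) ?_ ?_ ?_ (g, h)
  · intro t
    simp only [coeff_zero_eq_constantCoeff, map_mul]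
    simp only [← coeff_zero_eq_constantCoeff_apply, coeff_zero_formalEvalFun, map_mul]
  · intro t
    rw [Fintype.sum_prod_type, derivative_formalEvalFun]
    refine Finset.sum_congr rfl fun i _ => ?_
    rw [Fintype.sum_bool]
    simp only [if_true, Derivation.leibniz, smul_eq_mul, formalEvalFun_add, add_mul,
      Bool.false_eq_true, if_false]
    rw [add_comm, mul_comm t.2]
  · intro t
    rw [Fintype.sum_prod_type]
    simp only [Fintype.sum_bool, if_true, Derivation.leibniz, derivative_formalEvalFun,
      smul_eq_mul, Finset.mul_sum, Bool.false_eq_true, if_false]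
    rw [add_comm, ← Finset.sum_add_distrib]
    exact Finset.sum_congr rfl fun i _ => by ring

theorem formalEvalFun_algebraMap (P : ι → A⟦X⟧) (r : ℝ) :
    formalEvalFun D e P (algebraMap ℝ S r) = algebraMap ℝ A⟦X⟧ r := by
  refine eq_of_derivative_system (T := Unit) (κ := Empty) (fun _ t => t)
    (q := fun _ => 0) (F := fun _ => formalEvalFun D e P (algebraMap ℝ S r))
    (G := fun _ => algebraMap ℝ A⟦X⟧ r) ?_ ?_ ?_ ()
  · intro _
    rw [coeff_zero_formalEvalFun]
    simp [PowerSeries.algebraMap_apply]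
  · simp [derivative_formalEvalFun, formalEvalFun_zero]
  · simp [PowerSeries.algebraMap_apply]

/-- The evaluation at a formal point as a morphism of algebras. -/
noncomputable def formalEval (P : ι → A⟦X⟧) : S →ₐ[ℝ] A⟦X⟧ where
  toFun := formalEvalFun D e P
  map_zero' := formalEvalFun_zero D e P
  map_add' := formalEvalFun_add D e P
  map_one' := by simpa using formalEvalFun_algebraMap D e P 1
  map_mul' := formalEvalFun_mul D e P
  commutes' := formalEvalFun_algebraMap D e P

theorem coeff_zero_formalEval (P : ι → A⟦X⟧) (g : S) :
    coeff 0 (formalEval D e P g) = algebraMap ℝ A (e g) :=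
  coeff_zero_formalEvalFun D e P g

theorem derivative_formalEval (P : ι → A⟦X⟧) (g : S) :
    d⁄dX A (formalEval D e P g) = ∑ i, formalEval D e P (D i g) * d⁄dX A (P i) :=
  derivative_formalEvalFun D e P g

/-- Up to order `K`, the value at a formal point depends on the point only up to order `K`. -/
theorem coeff_formalEval_congr {P Q : ι → A⟦X⟧} (K : ℕ)
    (h : ∀ k ≤ K, ∀ i, coeff k (P i) = coeff k (Q i)) (g : S) :
    coeff K (formalEval D e P g) = coeff K (formalEval D e Q g) := by
  refine coeff_eq_of_derivative_system (fun i t => D i t) (q := fun i => d⁄dX A (P i))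
    (q' := fun i => d⁄dX A (Q i)) K ?_ ?_ ?_ ?_ K le_rfl g
  · intro t
    rw [coeff_zero_formalEval, coeff_zero_formalEval]
  · intro k _ t
    rw [derivative_formalEval]
  · intro k _ t
    rw [derivative_formalEval]
  · intro k hk i
    rw [coeff_derivative, coeff_derivative, h (k + 1) hk]

theorem PowerSeries.derivative_map {R R' : Type*} [CommSemiring R] [CommSemiring R']
    (φ : R →+* R') (F : R⟦X⟧) : d⁄dX R' (map φ F) = map φ (d⁄dX R F) := by
  ext k
  simp [coeff_derivative]

/-- The evaluation at formal points is natural in the algebra of coefficients. -/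
theorem map_formalEval (φ : A →ₐ[ℝ] B) (P : ι → A⟦X⟧) (g : S) :
    PowerSeries.map (φ : A →+* B) (formalEval D e P g) =
      formalEval D e (fun i => PowerSeries.map (φ : A →+* B) (P i)) g := by
  refine eq_of_derivative_system (fun i t => D i t)
    (q := fun i => d⁄dX B (PowerSeries.map (φ : A →+* B) (P i)))
    (F := fun t => PowerSeries.map (φ : A →+* B) (formalEval D e P t)) ?_ ?_ ?_ g
  · intro t
    rw [coeff_zero_formalEval, coeff_map, coeff_zero_formalEval]
    simp
  · intro t
    simp only [derivative_map, derivative_formalEval, map_sum, map_mul]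
  · intro t
    rw [derivative_formalEval]

/-! ### Taylor's formula at formal points -/

/-- The `n`-th term `(1/n!) ∑_b E(∂_b g) V_{b₁} ⋯ V_{bₙ}` of a Taylor expansion. -/
noncomputable def taylorTerm (E : S → A⟦X⟧) (V : ι → A⟦X⟧) : ℕ → S → A⟦X⟧
  | 0, g => E g
  | n + 1, g => ((n : ℝ) + 1)⁻¹ • ∑ i, V i * taylorTerm E V n (D i g)

theorem PowerSeries.derivative_real_smul (r : ℝ) (F : A⟦X⟧) :
    d⁄dX A (r • F) = r • d⁄dX A F := by
  ext k
  simp [coeff_derivative]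

/-- An increment without constant term makes the Taylor expansion finite at every order. -/
theorem X_pow_dvd_taylorTerm (E : S → A⟦X⟧) {V : ι → A⟦X⟧} (hV : ∀ i, coeff 0 (V i) = 0)
    (n : ℕ) (g : S) : X ^ n ∣ taylorTerm D E V n g := by
  induction n generalizing g with
  | zero => simp
  | succ n ih =>
    rw [taylorTerm, Algebra.smul_def]
    refine Dvd.dvd.mul_left (Finset.dvd_sum fun i _ => ?_) _
    rw [pow_succ']
    exact mul_dvd_mul (X_dvd_iff.2 (by simpa using hV i)) (ih _)

/-- The derivative hits either the coefficient, giving a term of the same degree times `dY`, or one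
of the `n + 1` equal factors `V`, which turns `1/(n+1)!` into `1/n!` and lowers the degree.
Commuting derivations make the factors interchangeable. -/
theorem derivative_taylorTerm_succ (hD : ∀ i j g, D i (D j g) = D j (D i g))
    (Y V : ι → A⟦X⟧) (n : ℕ) (g : S) :
    d⁄dX A (taylorTerm D (formalEval D e Y) V (n + 1) g) =
      ∑ i, (taylorTerm D (formalEval D e Y) V (n + 1) (D i g) * d⁄dX A (Y i) +
        taylorTerm D (formalEval D e Y) V n (D i g) * d⁄dX A (V i)) := by
  induction n generalizing g with
  | zero =>
    simp only [taylorTerm, derivative_formalEval, Nat.cast_zero, zero_add, inv_one, one_smul,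
      map_sum, Derivation.leibniz, smul_eq_mul, Finset.sum_add_distrib, Finset.mul_sum,
      Finset.sum_mul]
    congr 1
    rw [Finset.sum_comm]
    refine Finset.sum_congr rfl fun i _ => Finset.sum_congr rfl fun j _ => ?_
    rw [hD j i]
    ring
  | succ n ih =>
    have hu : ((n : ℝ) + 1 + 1) ≠ 0 := by positivity
    have hu' : ((n : ℝ) + 1) ≠ 0 := by positivity
    set E := formalEval D e Y with hE
    have h2 : ∀ g, ∑ i, V i * taylorTerm D E V n (D i g) =
        ((n : ℝ) + 1) • taylorTerm D E V (n + 1) g := by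
      intro g
      rw [taylorTerm, smul_inv_smul₀ hu']
    have h3 : ∀ g, ∑ i, V i * taylorTerm D E V (n + 1) (D i g) =
        ((n : ℝ) + 1 + 1) • taylorTerm D E V (n + 1 + 1) g := by
      intro g
      rw [taylorTerm]
      push_cast
      rw [smul_inv_smul₀ hu]
    -- Multiplying by `n + 2` clears the outer denominator. The product rule gives one copy of the
    -- `dV` sum directly and `n + 1` copies from the induction hypothesis.
    have key : ((n : ℝ) + 1 + 1) • d⁄dX A (taylorTerm D E V (n + 1 + 1) g) =
        ((n : ℝ) + 1 + 1) • ∑ i, (taylorTerm D E V (n + 1 + 1) (D i g) * d⁄dX A (Y i) +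
          taylorTerm D E V (n + 1) (D i g) * d⁄dX A (V i)) := by
      rw [← derivative_real_smul, ← h3, map_sum]
      simp only [Derivation.leibniz, ih, smul_eq_mul]
      simp only [Finset.mul_sum, Finset.sum_add_distrib, smul_add, mul_add, Finset.smul_sum]
      have e1 : ∑ i, ∑ j, V i * (taylorTerm D E V (n + 1) (D j (D i g)) * d⁄dX A (Y j)) =
          ∑ j, ((n : ℝ) + 1 + 1) • (taylorTerm D E V (n + 1 + 1) (D j g) * d⁄dX A (Y j)) := by
        rw [Finset.sum_comm]
        refine Finset.sum_congr rfl fun j _ => ?_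
        rw [← smul_mul_assoc, ← h3, Finset.sum_mul]
        refine Finset.sum_congr rfl fun i _ => ?_
        rw [hD i j]
        ring
      have e2 : ∑ i, ∑ j, V i * (taylorTerm D E V n (D j (D i g)) * d⁄dX A (V j)) =
          ∑ j, ((n : ℝ) + 1) • (taylorTerm D E V (n + 1) (D j g) * d⁄dX A (V j)) := by
        rw [Finset.sum_comm]
        refine Finset.sum_congr rfl fun j _ => ?_
        rw [← smul_mul_assoc, ← h2, Finset.sum_mul]
        refine Finset.sum_congr rfl fun i _ => ?_
        rw [hD i j]
        ring
      rw [e1, e2, add_assoc]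
      congr 1
      rw [← Finset.sum_add_distrib]
      refine Finset.sum_congr rfl fun j _ => ?_
      rw [add_smul ((n : ℝ) + 1) 1, one_smul]
    have := congrArg (fun a => ((n : ℝ) + 1 + 1)⁻¹ • a) key
    simpa only [inv_smul_smul₀ hu] using this

/-- Taylor's formula for the evaluation at formal points. -/
theorem coeff_formalEval_add (hD : ∀ i j g, D i (D j g) = D j (D i g))
    (Y : ι → A⟦X⟧) {V : ι → A⟦X⟧} (hV : ∀ i, coeff 0 (V i) = 0) {k K : ℕ} (hk : k ≤ K) (g : S) :
    coeff k (formalEval D e (fun i => Y i + V i) g) =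
      coeff k (∑ n ∈ Finset.range (K + 1), taylorTerm D (formalEval D e Y) V n g) := by
  refine coeff_eq_of_derivative_system (fun i t => D i t)
    (q := fun i => d⁄dX A (Y i + V i)) (q' := fun i => d⁄dX A (Y i + V i))
    (F := formalEval D e (fun i => Y i + V i))
    (G := fun g => ∑ n ∈ Finset.range (K + 1), taylorTerm D (formalEval D e Y) V n g)
    K ?_ ?_ ?_ (fun _ _ _ => rfl) k hk g
  · intro t
    rw [Finset.sum_range_succ', map_add, map_sum, Finset.sum_eq_zero, zero_add,
      coeff_zero_formalEval, taylorTerm, coeff_zero_formalEval]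
    intro n _
    exact X_pow_dvd_iff.1 (X_pow_dvd_taylorTerm D _ hV (n + 1) t) 0 (by omega)
  · intro k _ t
    rw [derivative_formalEval]
  · intro k hk t
    -- The truncated Taylor sum obeys the chain rule except for the `dV` contribution of degree `K`,
    -- which would come from the omitted term `K + 1`; being divisible by `X ^ K`, it is invisible
    -- below order `K`.
    have h1 : d⁄dX A (∑ n ∈ Finset.range (K + 1), taylorTerm D (formalEval D e Y) V n t) +
        ∑ i, taylorTerm D (formalEval D e Y) V K (D i t) * d⁄dX A (V i) =
        ∑ i, (∑ n ∈ Finset.range (K + 1), taylorTerm D (formalEval D e Y) V n (D i t)) *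
          d⁄dX A (Y i + V i) := by
      rw [Finset.sum_range_succ', map_add, map_sum]
      simp only [derivative_taylorTerm_succ D e hD]
      simp only [Finset.sum_add_distrib, map_add, mul_add, Finset.sum_mul]
      conv_rhs =>
        congr
        · rw [Finset.sum_congr rfl fun i _ => Finset.sum_range_succ' _ _, Finset.sum_add_distrib]
        · rw [Finset.sum_congr rfl fun i _ => Finset.sum_range_succ _ _, Finset.sum_add_distrib]
      rw [Finset.sum_comm, Finset.sum_comm (s := Finset.range K)]
      simp only [taylorTerm, derivative_formalEval]
      abel
    have h2 : coeff k (∑ i, taylorTerm D (formalEval D e Y) V K (D i t) * d⁄dX A (V i)) = 0 := by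
      rw [map_sum]
      exact Finset.sum_eq_zero fun i _ =>
        X_pow_dvd_iff.1 ((X_pow_dvd_taylorTerm D _ hV K (D i t)).mul_right _) k hk
    rw [← h1, map_add, h2, add_zero]

end FormalEvaluation

/-! ### The universal tree series and its fixed point equation -/

/-- The weight of a planar tree: the product over its vertices of `1/n!`, where `n` is the number of
children, that is, `w(B₊(τ₁ ⋯ τₙ)) = (1/n!) w(τ₁) ⋯ w(τₙ)`. -/
noncomputable def PTree.weight {d : ℕ} : PTree d → ℝ
  | node _ n c => (n.factorial : ℝ)⁻¹ * ∏ i, weight (c i)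

theorem PTree.size_pos {d : ℕ} (t : PTree d) : 1 ≤ t.size := by
  cases t
  simp [PTree.size]

noncomputable instance PTree.fintypeSizeLE (d K : ℕ) : Fintype {p : PTree d // p.size ≤ K} :=
  (PTree.finite_size_le K).fintype

section TreeSeries

open PowerSeries

variable {d : ℕ} {ι : Type*} [Fintype ι] {S : Type*} [CommRing S] [Algebra ℝ S]
  (D : ι → Derivation ℝ S S) (e : S →ₐ[ℝ] ℝ) {H : Type*} [CommRing H] [HopfAlgebra ℝ H]

/-- The iterated derivative `∑_b (∂_{b₁} ⋯ ∂_{bₙ} g) v₁^{b₁} ⋯ vₙ^{bₙ}`. -/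
noncomputable def iteratedDirDeriv : (n : ℕ) → S → (Fin n → ι → S) → S
  | 0, g, _ => g
  | n + 1, g, v => ∑ i, v 0 i * iteratedDirDeriv n (D i g) (Fin.tail v)

/-- Elementary differentials of planar trees for the components `f a i` of vector fields. -/
noncomputable def PTree.elemDiffAlg (f : Fin d → ι → S) : PTree d → ι → S
  | node a n c => fun i => iteratedDirDeriv D n (f a i) fun j => PTree.elemDiffAlg f (c j)

/-- The term of the universal tree series which is attached to a planar tree. -/
noncomputable def treeMonomial (L : Fin d → H →ₗ[ℝ] H) (p : PTree d) : H⟦X⟧ :=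
  monomial p.size (p.weight • p.toHopf L)

/-- The universal tree series `∑_p ε^|p| w(p) Λ(p) Υ[p](Y)` over planar trees with at most `K`
vertices. -/
noncomputable def treeSeries (L : Fin d → H →ₗ[ℝ] H) (f : Fin d → ι → S) (Y : ι → ℝ⟦X⟧)
    (K : ℕ) (i : ι) : H⟦X⟧ :=
  ∑ p : {p : PTree d // p.size ≤ K},
    treeMonomial L p.1 * map (algebraMap ℝ H) (formalEval D e Y (p.1.elemDiffAlg D f i))

/-- Multilinearity: choosing a summand in each of the `n` slots amounts to choosing the `n` subtrees
below a new root, and `1/n!` is the weight of that root. -/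
theorem taylorTerm_sum {τ : Type*} [Fintype τ] (M : τ → H⟦X⟧) (U : τ → ι → S)
    (E : S →ₐ[ℝ] H⟦X⟧) (n : ℕ) (g : S) :
    taylorTerm D E (fun i => ∑ p, M p * E (U p i)) n g =
      (n.factorial : ℝ)⁻¹ • ∑ c : Fin n → τ, (∏ j, M (c j)) *
        E (iteratedDirDeriv D n g fun j => U (c j)) := by
  induction n generalizing g with
  | zero => simp [taylorTerm, iteratedDirDeriv]
  | succ n ih =>
    simp only [taylorTerm, ih]
    rw [← (Fin.consEquiv fun _ : Fin (n + 1) => τ).sum_comp, Fintype.sum_prod_type]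
    simp only [Fin.consEquiv, Equiv.coe_fn_mk, Fin.prod_univ_succ, Fin.cons_zero, Fin.cons_succ,
      iteratedDirDeriv, map_sum, map_mul, mul_smul_comm, ← Finset.smul_sum]
    rw [smul_smul, Nat.factorial_succ]
    push_cast
    rw [mul_inv]
    congr 1
    simp only [Finset.sum_mul_sum]
    rw [Finset.sum_comm]
    refine Finset.sum_congr rfl fun p _ => ?_
    rw [Finset.sum_comm]
    refine Finset.sum_congr rfl fun c _ => ?_
    rw [Finset.mul_sum]
    refine Finset.sum_congr rfl fun i _ => ?_
    have : (Fin.tail fun j => U (Fin.cons (α := fun _ => τ) p c j)) = fun j => U (c j) := by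
      funext j
      simp [Fin.tail]
    rw [this]
    ring

/-- The analytic factor is a real scalar, so maps that are only `ℝ`-linear, such as `L a` or `Z`,
act on the factor in `H` alone. -/
theorem coeff_monomial_mul_map_algebraMap (k s : ℕ) (h : H) (r : ℝ⟦X⟧) :
    coeff k (monomial s h * map (algebraMap ℝ H) r) =
      if s ≤ k then coeff (k - s) r • h else 0 := by
  rw [monomial_eq_C_mul_X_pow, mul_right_comm, coeff_mul_X_pow', coeff_C_mul, coeff_map,
    mul_comm, Algebra.smul_def]

theorem coeff_zero_treeSeries (L : Fin d → H →ₗ[ℝ] H) (f : Fin d → ι → S) (Y : ι → ℝ⟦X⟧)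
    (K : ℕ) (i : ι) : coeff 0 (treeSeries D e L f Y K i) = 0 := by
  simp only [treeSeries, map_sum, treeMonomial, coeff_monomial_mul_map_algebraMap]
  refine Finset.sum_eq_zero fun p _ => if_neg ?_
  have := p.1.size_pos
  omega

/-- The tree series solves, up to order `K`, the fixed point equation
`P = Y + ε ∑ₐ Lₐ(fₐ(P))`. -/
theorem coeff_succ_treeSeries (hD : ∀ i j g, D i (D j g) = D j (D i g))
    (L : Fin d → H →ₗ[ℝ] H) (f : Fin d → ι → S) (Y : ι → ℝ⟦X⟧) {k K : ℕ} (hk : k + 1 ≤ K)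
    (i : ι) :
    coeff (k + 1) (treeSeries D e L f Y K i) = ∑ a, L a (coeff k (formalEval D e
      (fun i => map (algebraMap ℝ H) (Y i) + treeSeries D e L f Y K i) (f a i))) := by
  have hE : ∀ g, map (algebraMap ℝ H) (formalEval D e Y g) =
      formalEval D e (fun i => map (algebraMap ℝ H) (Y i)) g :=
    fun g => map_formalEval D e (Algebra.ofId ℝ H) Y g
  have h1 : ∀ a, coeff k (formalEval D e
      (fun i => map (algebraMap ℝ H) (Y i) + treeSeries D e L f Y K i) (f a i)) =
      ∑ n : Fin (K + 1), ∑ c : Fin n → {p : PTree d // p.size ≤ K},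
        ((n.1.factorial : ℝ)⁻¹) • (coeff k (monomial (∑ j, (c j).1.size)
          (∏ j, ((c j).1.weight • (c j).1.toHopf L)) * map (algebraMap ℝ H)
            (formalEval D e Y
              (iteratedDirDeriv D n (f a i) fun j => (c j).1.elemDiffAlg D f)))) := by
    intro a
    have hT : ∀ n, taylorTerm D (formalEval D e fun i => map (algebraMap ℝ H) (Y i))
        (treeSeries D e L f Y K) n (f a i) = _ := fun n => by
      have := taylorTerm_sum D (fun p : {p : PTree d // p.size ≤ K} => treeMonomial L p.1)
        (fun p => p.1.elemDiffAlg D f) (formalEval D e fun i => map (algebraMap ℝ H) (Y i)) n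
        (f a i)
      simp only [← hE] at this ⊢
      exact this
    have hM : ∀ (n : ℕ) (c : Fin n → {p : PTree d // p.size ≤ K}),
        ∏ j, treeMonomial L (c j).1 = monomial (∑ j, (c j).1.size)
          (∏ j, ((c j).1.weight • (c j).1.toHopf L)) := by
      intro n c
      simp only [treeMonomial, monomial_eq_C_mul_X_pow, Finset.prod_mul_distrib, map_prod,
        Finset.prod_pow_eq_pow_sum]
    rw [coeff_formalEval_add D e hD _ (coeff_zero_treeSeries D e L f Y K)
      (show k ≤ K by omega), Finset.sum_range, map_sum]
    refine Finset.sum_congr rfl fun n _ => ?_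
    rw [hT]
    simp only [hM, Finset.smul_sum, map_sum]
    refine Finset.sum_congr rfl fun c _ => ?_
    simp
  simp only [h1, coeff_monomial_mul_map_algebraMap, map_sum]
  rw [treeSeries, map_sum]
  -- Grafting data: root decoration, arity, subtrees. An arity up to `K` suffices because each child
  -- has at least one vertex.
  let G : (Fin d × Σ n : Fin (K + 1), Fin n → {p : PTree d // p.size ≤ K}) → H := fun x =>
    L x.1 ((x.2.1.1.factorial : ℝ)⁻¹ • if ∑ j, (x.2.2 j).1.size ≤ k then
      coeff (k - ∑ j, (x.2.2 j).1.size) (formalEval D e Y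
        (iteratedDirDeriv D x.2.1 (f x.1 i) fun j => (x.2.2 j).1.elemDiffAlg D f)) •
      ∏ j, ((x.2.2 j).1.weight • (x.2.2 j).1.toHopf L) else 0)
  have hG : ∀ x, G x = coeff (k + 1) (treeMonomial L
      (PTree.node x.1 x.2.1.1 fun j => (x.2.2 j).1) * map (algebraMap ℝ H) (formalEval D e Y
        ((PTree.node x.1 x.2.1.1 fun j => (x.2.2 j).1).elemDiffAlg D f i))) := by
    rintro ⟨a, n, c⟩
    rw [treeMonomial, coeff_monomial_mul_map_algebraMap]
    simp only [G, PTree.size, PTree.weight, PTree.toHopf, PTree.elemDiffAlg]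
    by_cases hs : ∑ j, (c j).1.size ≤ k
    · rw [if_pos hs, if_pos (by omega), map_smul, map_smul, show k + 1 - (1 + ∑ j, (c j).1.size) =
        k - ∑ j, (c j).1.size by omega, Finset.prod_smul, map_smul]
      simp only [smul_smul]
      congr 1
      ring
    · rw [if_neg hs, if_neg (by omega), smul_zero, map_zero]
  have hsum : ∑ x, G x = ∑ a, ∑ n : Fin (K + 1), ∑ c : Fin n → {p : PTree d // p.size ≤ K},
      G ⟨a, n, c⟩ := by
    rw [Fintype.sum_prod_type]
    exact Finset.sum_congr rfl fun a _ => Fintype.sum_sigma _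
  refine Eq.trans ?_ hsum
  have hinj : Function.Injective fun x : (Fin d × Σ n : Fin (K + 1), Fin n →
      {p : PTree d // p.size ≤ K}) => PTree.node x.1 x.2.1.1 fun j => (x.2.2 j).1 := by
    rintro ⟨a, ⟨n, hn⟩, c⟩ ⟨a', ⟨n', hn'⟩, c'⟩ h
    obtain ⟨rfl, rfl, h⟩ := PTree.node.inj h
    obtain rfl : c = c' := funext fun j => Subtype.ext (congrFun (eq_of_heq h) j)
    rfl
  have hsurj : ∀ p : PTree d, p.size ≤ K → ∃ x : (Fin d × Σ n : Fin (K + 1), Fin n →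
      {p : PTree d // p.size ≤ K}), (PTree.node x.1 x.2.1.1 fun j => (x.2.2 j).1) = p := by
    rintro ⟨a, n, c⟩ hp
    simp only [PTree.size] at hp
    have hn : n ≤ ∑ j, (c j).size := by
      simpa using Finset.sum_le_sum fun j (_ : j ∈ Finset.univ) => (c j).size_pos
    have hc : ∀ j, (c j).size ≤ K := fun j =>
      (Finset.single_le_sum (f := fun i => (c i).size) (fun _ _ => Nat.zero_le _)
        (Finset.mem_univ j)).trans (by omega)
    exact ⟨⟨a, ⟨n, by omega⟩, fun j => ⟨c j, hc j⟩⟩, rfl⟩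
  choose σ hσ using hsurj
  refine Finset.sum_of_injOn (fun p => σ p.1 p.2) ?_ (by simp) ?_ ?_
  · intro p _ q _ hpq
    have h := hσ p.1 p.2
    simp only at hpq
    rw [hpq, hσ] at h
    exact Subtype.ext h.symm
  -- Data not coming from a tree of size at most `K` graft to a larger tree, which contributes
  -- nothing at order `k + 1 ≤ K`.
  · intro x _ hx
    rw [hG, treeMonomial, coeff_monomial_mul_map_algebraMap]
    refine if_neg fun hs => hx ?_
    exact ⟨⟨_, hs.trans hk⟩, by simp, hinj (hσ _ _)⟩
  · intro p _
    rw [hG, hσ]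

/-- Solutions of the fixed point equation `P = Y + ε ∑ₐ Lₐ(fₐ(P))` are unique. -/
theorem coeff_eq_of_fixedPoint (L : Fin d → H →ₗ[ℝ] H) (f : Fin d → ι → S) {P Q : ι → H⟦X⟧}
    {Y : ι → ℝ⟦X⟧} (K : ℕ) (hP0 : ∀ i, coeff 0 (P i) = coeff 0 (Q i))
    (hP : ∀ k < K, ∀ i, coeff (k + 1) (P i) = algebraMap ℝ H (coeff (k + 1) (Y i)) +
      ∑ a, L a (coeff k (formalEval D e P (f a i))))
    (hQ : ∀ k < K, ∀ i, coeff (k + 1) (Q i) = algebraMap ℝ H (coeff (k + 1) (Y i)) +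
      ∑ a, L a (coeff k (formalEval D e Q (f a i)))) :
    ∀ k ≤ K, ∀ i, coeff k (P i) = coeff k (Q i) := by
  intro k
  induction k using Nat.strong_induction_on with
  | _ k ih =>
    intro hk i
    cases k with
    | zero => exact hP0 i
    | succ k =>
      rw [hP k hk, hQ k hk]
      congr 1
      refine Finset.sum_congr rfl fun a _ => ?_
      -- The factor `ε` closes the induction: order `k + 1` of a solution depends on its orders up
      -- to `k` only.
      rw [coeff_formalEval_congr D e k fun j hj => ih j (by omega) (by omega)]

/-- A morphism `φ` intertwining the `Lₐ` up to the scalars `ζ(Lₐ u)` moves the base point of the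
tree series. -/
theorem map_coeff_treeSeries (hD : ∀ i j g, D i (D j g) = D j (D i g))
    (L : Fin d → H →ₗ[ℝ] H) (f : Fin d → ι → S) (φ : H →ₐ[ℝ] H) (ζ : H →ₗ[ℝ] ℝ)
    (hφ : ∀ a u, φ (L a u) = L a (φ u) + algebraMap ℝ H (ζ (L a u))) (Y Y' : ι → ℝ⟦X⟧) (K : ℕ)
    (hY : ∀ k ≤ K, ∀ i, coeff k (Y' i) = coeff k (Y i) + ζ (coeff k (treeSeries D e L f Y K i))) :
    ∀ k ≤ K, ∀ i, algebraMap ℝ H (coeff k (Y i)) + φ (coeff k (treeSeries D e L f Y K i)) =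
      algebraMap ℝ H (coeff k (Y' i)) + coeff k (treeSeries D e L f Y' K i) := by
  set P : ι → H⟦X⟧ := fun i => map (algebraMap ℝ H) (Y i) + treeSeries D e L f Y K i with hP
  have hc : ∀ k i, coeff k (map (φ : H →+* H) (P i)) =
      algebraMap ℝ H (coeff k (Y i)) + φ (coeff k (treeSeries D e L f Y K i)) := by
    intro k i
    simp [hP]
  have key := coeff_eq_of_fixedPoint D e L f (P := fun i => map (φ : H →+* H) (P i))
    (Q := fun i => map (algebraMap ℝ H) (Y' i) + treeSeries D e L f Y' K i) (Y := Y') K ?_ ?_ ?_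
  · intro k hk i
    rw [← hc, key k hk, map_add, coeff_map]
  · intro i
    rw [hc, map_add, coeff_map, coeff_zero_treeSeries, coeff_zero_treeSeries, hY 0 (Nat.zero_le _),
      coeff_zero_treeSeries, map_zero, map_zero, add_zero, add_zero, add_zero]
  · intro k hk i
    rw [hc, hY (k + 1) hk, coeff_succ_treeSeries D e hD L f Y hk]
    simp only [map_sum, hφ, Finset.sum_add_distrib, map_add]
    -- The scalars `ζ (L a _)` add up to the shift of the base point from `Y` to `Y'`.
    rw [add_comm (∑ a, L a _), ← add_assoc]
    congr 1
    refine Finset.sum_congr rfl fun a _ => ?_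
    -- Here multiplicativity of `φ` matters: it passes through the evaluation of `f a i`.
    rw [← map_formalEval, coeff_map]
    rfl
  · intro k hk i
    rw [map_add, coeff_map, coeff_succ_treeSeries D e hD L f Y' hk]

end TreeSeries

/-! ### Symmetry factors as sums over planar representatives -/

section SymmetryFactor

variable {d : ℕ}

theorem RTree.mk_node_eq_iff {a : Fin d} {n : ℕ} {c c' : Fin n → PTree d} :
    RTree.mk (PTree.node a n c) = RTree.mk (PTree.node a n c') ↔
      ∃ s : Equiv.Perm (Fin n), ∀ i, RTree.mk (c i) = RTree.mk (c' (s i)) := by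
  rw [RTree.mk_eq_mk]
  constructor
  · rintro ⟨_, _, _, _, s, h⟩
    exact ⟨s, fun i => RTree.mk_eq_mk.2 (h i)⟩
  · rintro ⟨s, h⟩
    exact PTree.Iso.node a n c c' s fun i => RTree.mk_eq_mk.1 (h i)

/-- The permutations counted form a coset, through `s₀`, of the stabilizer of `v`, which permutes
each fiber of `v` independently. -/
theorem card_perm_comp_eq {α β : Type*} [Fintype α] [DecidableEq α] [DecidableEq β] (v : α → β)
    (s₀ : Equiv.Perm α) :
    Fintype.card {s : Equiv.Perm α // ∀ i, v (s₀ i) = v (s i)} =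
      ∏ x ∈ Finset.univ.image v, (Finset.univ.filter fun i => v i = x).card.factorial := by
  simp only [← Fintype.card_subtype]
  rw [← DomMulAct.stabilizer_card' v]
  refine Fintype.card_congr ((Equiv.mulRight s₀⁻¹).subtypeEquiv fun s => ?_)
  rw [funext_iff]
  simp only [Function.comp, Equiv.coe_mulRight, Equiv.Perm.mul_apply]
  constructor
  · intro h i
    rw [← h]
    simp
  · intro h i
    have := h (s₀ i)
    rw [← Equiv.Perm.mul_apply s₀⁻¹, inv_mul_cancel] at this
    exact this.symm

open Classical in
/-- The weights of the planar trees over a rooted tree sum up to the inverse of its symmetry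
factor. -/
theorem PTree.sum_weight_fiber (p₀ : PTree d) (K : ℕ) (hK : p₀.size ≤ K) :
    ∑ p : {p : PTree d // p.size ≤ K},
      (if RTree.mk p.1 = RTree.mk p₀ then p.1.weight else 0) = (p₀.symFactor : ℝ)⁻¹ := by
  induction p₀ with
  | node a n c₀ ih =>
    simp only [PTree.size] at hK
    have hc : ∀ j, (c₀ j).size ≤ K := fun j =>
      (Finset.single_le_sum (f := fun i => (c₀ i).size) (fun _ _ => Nat.zero_le _)
        (Finset.mem_univ j)).trans (by omega)
    set T := {p : PTree d // p.size ≤ K}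
    set R : ℕ := ∏ x ∈ Finset.univ.image fun i => RTree.mk (c₀ i),
      (Finset.univ.filter fun i => RTree.mk (c₀ i) = x).card.factorial with hR
    have hR0 : (R : ℝ) ≠ 0 := by
      rw [hR]
      exact_mod_cast Finset.prod_ne_zero_iff.2 fun _ _ => Nat.factorial_ne_zero _
    -- Isomorphic trees share root decoration and arity, so the fiber is parametrised by `n`-tuples
    -- of subtrees.
    have h1 : ∑ p : T, (if RTree.mk p.1 = RTree.mk (PTree.node a n c₀) then p.1.weight else 0) =
        ∑ c : Fin n → T, if RTree.mk (PTree.node a n fun j => (c j).1) =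
          RTree.mk (PTree.node a n c₀) then (PTree.node a n fun j => (c j).1).weight else 0 := by
      rw [← Finset.sum_filter, ← Finset.sum_filter]
      symm
      have hsz : ∀ c : Fin n → T, RTree.mk (PTree.node a n fun j => (c j).1) =
          RTree.mk (PTree.node a n c₀) → (PTree.node a n fun j => (c j).1).size ≤ K := by
        intro c h
        rw [(RTree.mk_eq_mk.1 h).size_eq]
        exact hK
      refine Finset.sum_bij (fun c hc => ⟨PTree.node a n fun j => (c j).1,
        hsz c (Finset.mem_filter.1 hc).2⟩) ?_ ?_ ?_ ?_
      · intro c hc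
        simpa using hc
      · intro c _ c' _ h
        have h' := (PTree.node.inj (Subtype.mk.inj h)).2.2
        exact funext fun j => Subtype.ext (congrFun (eq_of_heq h') j)
      · rintro ⟨p, hp⟩ h
        have hiso := RTree.mk_eq_mk.1 (Finset.mem_filter.1 h).2
        cases hiso with
        | node _ _ c _ s hs =>
          simp only [PTree.size] at hp
          refine ⟨fun j => ⟨c j, ?_⟩, by simpa using h, rfl⟩
          exact (Finset.single_le_sum (f := fun i => (c i).size) (fun _ _ => Nat.zero_le _)
            (Finset.mem_univ j)).trans (by omega)
      · intro c _
        rfl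
    -- For a tuple in the fiber exactly `R` permutations match its subtrees with those of `c₀`,
    -- otherwise none does. Summing over permutations thus replaces the isomorphism condition by one
    -- that factors over the children.
    have h2 : ∀ c : Fin n → T, (R : ℝ) * (if RTree.mk (PTree.node a n fun j => (c j).1) =
          RTree.mk (PTree.node a n c₀) then (PTree.node a n fun j => (c j).1).weight else 0) =
        (n.factorial : ℝ)⁻¹ * ∑ s : Equiv.Perm (Fin n), ∏ j,
          if RTree.mk (c j).1 = RTree.mk (c₀ (s j)) then (c j).1.weight else 0 := by
      intro c
      have h3 : ∀ s : Equiv.Perm (Fin n), (∏ j,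
          if RTree.mk (c j).1 = RTree.mk (c₀ (s j)) then (c j).1.weight else 0) =
          if ∀ j, RTree.mk (c j).1 = RTree.mk (c₀ (s j)) then ∏ j, (c j).1.weight else 0 := by
        intro s
        by_cases h : ∀ j, RTree.mk (c j).1 = RTree.mk (c₀ (s j))
        · rw [if_pos h]
          exact Finset.prod_congr rfl fun j _ => if_pos (h j)
        · rw [if_neg h]
          push Not at h
          obtain ⟨j, hj⟩ := h
          exact Finset.prod_eq_zero (Finset.mem_univ j) (if_neg hj)
      simp only [h3]
      rw [← Finset.sum_filter, Finset.sum_const, nsmul_eq_mul, ← Fintype.card_subtype]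
      by_cases h : RTree.mk (PTree.node a n fun j => (c j).1) = RTree.mk (PTree.node a n c₀)
      · rw [if_pos h, PTree.weight]
        obtain ⟨s₀, hs₀⟩ := RTree.mk_node_eq_iff.1 h
        simp only [hs₀]
        rw [hR, ← card_perm_comp_eq (fun i => RTree.mk (c₀ i)) s₀, Fintype.card_eq_nat_card,
          Fintype.card_eq_nat_card]
        ring
      · rw [if_neg h, Fintype.card_eq_zero_iff.2 ⟨fun s => h (RTree.mk_node_eq_iff.2 ⟨s.1, s.2⟩)⟩]
        simp
    have h4 : (R : ℝ) * ∑ p : T, (if RTree.mk p.1 = RTree.mk (PTree.node a n c₀)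
        then p.1.weight else 0) = ∏ j, ((c₀ j).symFactor : ℝ)⁻¹ := by
      rw [h1, Finset.mul_sum]
      simp only [h2]
      rw [← Finset.mul_sum, Finset.sum_comm]
      have h5 : ∀ s : Equiv.Perm (Fin n), ∑ c : Fin n → T, ∏ j,
          (if RTree.mk (c j).1 = RTree.mk (c₀ (s j)) then (c j).1.weight else 0) =
          ∏ j, ((c₀ j).symFactor : ℝ)⁻¹ := by
        intro s
        have := Finset.prod_univ_sum (fun _ : Fin n => (Finset.univ : Finset T)) (fun j p =>
          if RTree.mk p.1 = RTree.mk (c₀ (s j)) then p.1.weight else 0)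
        rw [Fintype.piFinset_univ] at this
        rw [← this, ← Equiv.prod_comp s fun j => ((c₀ j).symFactor : ℝ)⁻¹]
        exact Finset.prod_congr rfl fun j _ => ih (s j) (hc _)
      simp only [h5]
      -- All `n!` permutations contribute equally and cancel the root weight `1/n!`.
      rw [Finset.sum_const, Finset.card_univ, Fintype.card_perm, Fintype.card_fin, nsmul_eq_mul,
        inv_mul_cancel_left₀ (by exact_mod_cast Nat.factorial_ne_zero n)]
    rw [PTree.symFactor, Nat.cast_mul, mul_inv, ← hR, Nat.cast_prod (fun i => (c₀ i).symFactor),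
      ← Finset.prod_inv_distrib, ← h4, inv_mul_cancel_left₀ hR0]

theorem RTree.mem_ofSize {s : ℕ} {t : RTree d} : t ∈ RTree.ofSize d s ↔ t.size = s := by
  rw [RTree.ofSize, Set.Finite.mem_toFinset, Set.mem_ofPred_eq]

/-- Sums over rooted trees weighted by the inverse symmetry factors are sums over planar trees. -/
theorem RTree.sum_ofSize_eq {M : Type*} [AddCommGroup M] [Module ℝ M] {s K : ℕ} (h : s ≤ K)
    (G : RTree d → M) :
    ∑ t ∈ RTree.ofSize d s, (t.symFactor : ℝ)⁻¹ • G t =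
      ∑ p : {p : PTree d // p.size ≤ K},
        if p.1.size = s then p.1.weight • G (RTree.mk p.1) else 0 := by
  classical
  have h1 : ∀ t ∈ RTree.ofSize d s, (t.symFactor : ℝ)⁻¹ • G t =
      ∑ p : {p : PTree d // p.size ≤ K}, if RTree.mk p.1 = t then
        p.1.weight • G (RTree.mk p.1) else 0 := by
    intro t ht
    obtain ⟨p₀, rfl⟩ := Quotient.exists_rep t
    have hs : p₀.size = s := RTree.mem_ofSize.1 ht
    change (p₀.symFactor : ℝ)⁻¹ • G (RTree.mk p₀) = ∑ p : {p : PTree d // p.size ≤ K},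
      if RTree.mk p.1 = RTree.mk p₀ then p.1.weight • G (RTree.mk p.1) else 0
    rw [← PTree.sum_weight_fiber p₀ K (by omega), Finset.sum_smul]
    refine Finset.sum_congr rfl fun p _ => ?_
    split_ifs with hp
    · rw [hp]
    · rw [zero_smul]
  rw [Finset.sum_congr rfl h1, Finset.sum_comm]
  refine Finset.sum_congr rfl fun p _ => ?_
  rw [Finset.sum_ite_eq]
  have : RTree.mk p.1 ∈ RTree.ofSize d s ↔ p.1.size = s := RTree.mem_ofSize
  simp only [this]

end SymmetryFactor

/-! ### Smooth functions as a differential algebra, and the Taylor form of their evaluation -/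

section SmoothFunctions

open PowerSeries

variable {m : ℕ}

/-- The algebra of smooth functions on `ℝ^m`. -/
noncomputable def smoothFunctions (m : ℕ) : Subalgebra ℝ (EuclideanSpace ℝ (Fin m) → ℝ) where
  carrier := {g | ContDiff ℝ ∞ g}
  mul_mem' := fun {f g} hf hg => by
    rw [Set.mem_ofPred_eq] at *
    exact ContDiff.mul hf hg
  add_mem' := fun {f g} hf hg => by
    rw [Set.mem_ofPred_eq] at *
    exact ContDiff.add hf hg
  algebraMap_mem' := fun r => by
    rw [Set.mem_ofPred_eq]
    exact contDiff_const

theorem mem_smoothFunctions {g : EuclideanSpace ℝ (Fin m) → ℝ} :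
    g ∈ smoothFunctions m ↔ ContDiff ℝ ∞ g := Iff.rfl

theorem contDiff_of_smoothFunctions (g : smoothFunctions m) : ContDiff ℝ ∞ g.1 :=
  mem_smoothFunctions.1 g.2

theorem differentiable_of_smoothFunctions (g : smoothFunctions m) : Differentiable ℝ g.1 :=
  (contDiff_of_smoothFunctions g).differentiable (by simp)

/-- The partial derivatives as derivations of the algebra of smooth functions. -/
noncomputable def smoothPartial (i : Fin m) :
    Derivation ℝ (smoothFunctions m) (smoothFunctions m) :=
  Derivation.mk'
    { toFun := fun g => ⟨fun x => fderiv ℝ g.1 x (EuclideanSpace.single i 1),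
        mem_smoothFunctions.2 (((contDiff_of_smoothFunctions g).fderiv_right (m := ∞)
          (by exact_mod_cast le_top)).clm_apply contDiff_const)⟩
      map_add' := fun g h => by
        ext x
        change fderiv ℝ (g.1 + h.1) x _ = _
        rw [fderiv_add (differentiable_of_smoothFunctions g x) (differentiable_of_smoothFunctions h x)]
        rfl
      map_smul' := fun r g => by
        ext x
        change fderiv ℝ (r • g.1) x _ = _
        rw [fderiv_const_smul (differentiable_of_smoothFunctions g x)]
        rfl }
    (fun g h => by
      ext x
      change fderiv ℝ (g.1 * h.1) x _ = g.1 x * fderiv ℝ h.1 x _ + h.1 x * fderiv ℝ g.1 x _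
      rw [fderiv_mul (differentiable_of_smoothFunctions g x) (differentiable_of_smoothFunctions h x)]
      simp)

theorem smoothPartial_comm (i j : Fin m) (g : smoothFunctions m) :
    smoothPartial i (smoothPartial j g) = smoothPartial j (smoothPartial i g) := by
  have hd : Differentiable ℝ (fderiv ℝ g.1) :=
    ((contDiff_of_smoothFunctions g).fderiv_right (m := ∞) (by exact_mod_cast le_top)).differentiable (by simp)
  have key : ∀ (i j : Fin m) x, (smoothPartial i (smoothPartial j g)).1 x =
      fderiv ℝ (fderiv ℝ g.1) x (EuclideanSpace.single i 1) (EuclideanSpace.single j 1) := by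
    intro i j x
    change fderiv ℝ (fun x => fderiv ℝ g.1 x (EuclideanSpace.single j 1)) x _ = _
    rw [fderiv_clm_apply hd.differentiableAt (differentiableAt_const _)]
    simp
  ext x
  rw [key, key]
  have hg : ContDiff ℝ ∞ g.1 := contDiff_of_smoothFunctions g
  exact (hg.contDiffAt.isSymmSndFDerivAt (by
    simp only [minSmoothness_of_isRCLikeNormedField]
    exact (mod_cast le_top : (((2 : ℕ) : ℕ∞) : WithTop ℕ∞) ≤ ∞))).eq _ _

/-- The evaluation of smooth functions at a point. -/
noncomputable def smoothEvalAt (y : EuclideanSpace ℝ (Fin m)) : smoothFunctions m →ₐ[ℝ] ℝ :=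
  (Pi.evalAlgHom ℝ (fun _ : EuclideanSpace ℝ (Fin m) => ℝ) y).comp (smoothFunctions m).val

theorem smoothEvalAt_apply (y : EuclideanSpace ℝ (Fin m)) (g : smoothFunctions m) :
    smoothEvalAt y g = g.1 y := rfl

/-- Symmetry of the iterated derivative moves the first direction to the last slot, that of the
innermost derivative, where it is expanded in the standard basis. -/
theorem iteratedFDeriv_succ_apply_eq_sum (n : ℕ) (g : smoothFunctions m)
    (y : EuclideanSpace ℝ (Fin m)) (v : Fin (n + 1) → EuclideanSpace ℝ (Fin m)) :
    iteratedFDeriv ℝ (n + 1) g.1 y v =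
      ∑ i, v 0 i * iteratedFDeriv ℝ n (smoothPartial i g).1 y (Fin.tail v) := by
  have hg : ContDiff ℝ ∞ g.1 := contDiff_of_smoothFunctions g
  have hd : ContDiff ℝ ∞ (fderiv ℝ g.1) := hg.fderiv_right (m := ∞) (by exact_mod_cast le_top)
  have h1 := iteratedFDeriv_comp_perm_of_smooth hg (n + 1) y v (finRotate (n + 1))
  have h2 : Fin.init (v ∘ finRotate (n + 1)) = Fin.tail v := by
    funext j
    simp [Fin.init, Fin.tail]
  have h3 : (v ∘ finRotate (n + 1)) (Fin.last n) = v 0 := by simp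
  rw [← h1, iteratedFDeriv_succ_apply_right, h2, h3]
  have h4 : v 0 = ∑ i, v 0 i • EuclideanSpace.single i (1 : ℝ) := by
    ext j
    simp [Finset.sum_apply, Pi.single_apply]
  conv_lhs => rw [h4]
  rw [map_sum]
  refine Finset.sum_congr rfl fun i _ => ?_
  rw [map_smul, smul_eq_mul]
  congr 1
  have h5 := ContinuousLinearMap.iteratedFDeriv_comp_left
    (ContinuousLinearMap.apply ℝ ℝ (EuclideanSpace.single i (1 : ℝ))) (hd.contDiffAt (x := y))
    (i := n) (by exact_mod_cast le_top)
  exact (congrArg (fun M => M (Fin.tail v)) h5).symm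

theorem iteratedDirDeriv_smooth_apply (n : ℕ) (g : smoothFunctions m)
    (v : Fin n → Fin m → smoothFunctions m) (y : EuclideanSpace ℝ (Fin m))
    (w : Fin n → EuclideanSpace ℝ (Fin m)) (h : ∀ j i, w j i = (v j i).1 y) :
    (iteratedDirDeriv smoothPartial n g v).1 y = iteratedFDeriv ℝ n g.1 y w := by
  induction n generalizing g with
  | zero => simp [iteratedDirDeriv]
  | succ n ih =>
    rw [iteratedFDeriv_succ_apply_eq_sum]
    have : ∀ x : smoothFunctions m, x.1 y = smoothEvalAt y x := fun _ => rfl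
    rw [iteratedDirDeriv, this, map_sum]
    refine Finset.sum_congr rfl fun i _ => ?_
    rw [map_mul, h, ← ih (smoothPartial i g) (Fin.tail v) (Fin.tail w) fun j i => h _ _]
    rfl

/-- The components of a smooth map. -/
noncomputable def smoothComponent (g : EuclideanSpace ℝ (Fin m) → EuclideanSpace ℝ (Fin m))
    (hg : ContDiff ℝ ∞ g) (i : Fin m) : smoothFunctions m :=
  ⟨fun x => g x i, mem_smoothFunctions.2 ((EuclideanSpace.proj (𝕜 := ℝ) i).contDiff.comp hg)⟩

theorem iteratedFDeriv_smoothComponent (g : EuclideanSpace ℝ (Fin m) → EuclideanSpace ℝ (Fin m))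
    (hg : ContDiff ℝ ∞ g) (i : Fin m) (n : ℕ) (y : EuclideanSpace ℝ (Fin m))
    (v : Fin n → EuclideanSpace ℝ (Fin m)) :
    iteratedFDeriv ℝ n (smoothComponent g hg i).1 y v = iteratedFDeriv ℝ n g y v i := by
  have h := ContinuousLinearMap.iteratedFDeriv_comp_left (EuclideanSpace.proj (𝕜 := ℝ) i)
    (hg.contDiffAt (x := y)) (i := n) (by exact_mod_cast le_top)
  exact congrArg (fun M => M v) h

theorem PTree.elemDiff_eq_elemDiffAlg {d : ℕ}
    (f : Fin d → EuclideanSpace ℝ (Fin m) → EuclideanSpace ℝ (Fin m))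
    (hf : ∀ a, ContDiff ℝ ∞ (f a)) (p : PTree d) (y : EuclideanSpace ℝ (Fin m)) (i : Fin m) :
    p.elemDiff f y i =
      (p.elemDiffAlg smoothPartial (fun a => smoothComponent (f a) (hf a)) i).1 y := by
  induction p generalizing i with
  | node a n c ih =>
    rw [PTree.elemDiff, PTree.elemDiffAlg, ← iteratedFDeriv_smoothComponent _ (hf a),
      iteratedDirDeriv_smooth_apply _ _ _ _ (fun j => (c j).elemDiff f y) ih]

theorem Composition.sum_zero (F : List ℕ → ℝ) : ∑ c : Composition 0, F c.blocks = F [] := by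
  have : ∀ c : Composition 0, c.blocks = [] := fun c => by
    have := c.length_le
    rwa [Composition.length, Nat.le_zero, List.length_eq_zero_iff] at this
  simp only [this]
  rw [Finset.sum_const, Finset.card_univ, composition_card]
  simp

/-- Splits off the first block, written `x.1 + 1` because blocks are positive. -/
theorem Composition.sum_blocks_succ (N : ℕ) (F : List ℕ → ℝ) :
    ∑ c : Composition (N + 1), F c.blocks =
      ∑ x ∈ Finset.HasAntidiagonal.antidiagonal N, ∑ c : Composition x.2,
        F ((x.1 + 1) :: c.blocks) := by
  rw [Finset.Nat.sum_antidiagonal_eq_sum_range_succ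
    (fun p q => ∑ c : Composition q, F ((p + 1) :: c.blocks)), Finset.sum_range,
    ← Fintype.sum_sigma' fun (p : Fin (N + 1)) (c : Composition (N - p)) => F ((p + 1) :: c.blocks)]
  symm
  refine Fintype.sum_bijective (fun x : (Σ p : Fin (N + 1), Composition (N - p)) =>
    (⟨(x.1 + 1) :: x.2.blocks, fun {j} hj => ?_, ?_⟩ : Composition (N + 1))) ⟨?_, ?_⟩ _ _
    fun _ => rfl
  · rcases List.mem_cons.1 hj with rfl | hj
    · omega
    · exact x.2.blocks_pos hj
  · have := x.1.2
    rw [List.sum_cons, x.2.blocks_sum]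
    omega
  · rintro ⟨p, c⟩ ⟨p', c'⟩ h
    obtain ⟨h1, h2⟩ := List.cons.inj (congrArg Composition.blocks h)
    obtain rfl : p = p' := Fin.ext (by simpa using h1)
    obtain rfl : c = c' := Composition.ext h2
    rfl
  · rintro ⟨l, hl, hs⟩
    cases l with
    | nil => simp at hs
    | cons p l =>
      have hp : 0 < p := hl (by simp)
      rw [List.sum_cons] at hs
      refine ⟨⟨⟨p - 1, by omega⟩, ⟨l, fun h => hl (by simp [h]), ?_⟩⟩, ?_⟩
      · simp only
        omega
      · refine Composition.ext ?_
        simp only [Nat.sub_add_cancel hp]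

/-- The term of a formal Taylor expansion which belongs to a list of exponents. -/
noncomputable def taylorListTerm (y : EuclideanSpace ℝ (Fin m)) (Y : FormalPoint m)
    (g : smoothFunctions m) (l : List ℕ) : ℝ :=
  (l.length.factorial : ℝ)⁻¹ * iteratedFDeriv ℝ l.length g.1 y fun i => Y (l.get i)

theorem taylorListTerm_cons (y : EuclideanSpace ℝ (Fin m)) (Y : FormalPoint m)
    (g : smoothFunctions m) (p : ℕ) (l : List ℕ) :
    taylorListTerm y Y g (p :: l) =
      ((l.length : ℝ) + 1)⁻¹ * ∑ i, Y p i * taylorListTerm y Y (smoothPartial i g) l := by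
  unfold taylorListTerm
  change ((l.length + 1).factorial : ℝ)⁻¹ * iteratedFDeriv ℝ (l.length + 1) g.1 y _ = _
  rw [iteratedFDeriv_succ_apply_eq_sum, Nat.factorial_succ]
  push_cast
  rw [mul_inv, mul_assoc, Finset.mul_sum]
  congr 1
  refine Finset.sum_congr rfl fun i _ => ?_
  rw [mul_left_comm]
  rfl

theorem formalEval_C {ι S A : Type*} [Fintype ι] [CommRing S] [Algebra ℝ S] [CommRing A]
    [Algebra ℝ A] (D : ι → Derivation ℝ S S) (e : S →ₐ[ℝ] ℝ) (a : ι → A) (g : S) :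
    formalEval D e (fun i => C (a i)) g = C (algebraMap ℝ A (e g)) := by
  refine eq_of_derivative_system (T := Unit) (κ := Empty) (fun _ t => t) (q := fun _ => 0)
    (F := fun _ => formalEval D e (fun i => C (a i)) g)
    (G := fun _ => C (algebraMap ℝ A (e g))) ?_ ?_ ?_ ()
  · intro _
    rw [coeff_zero_formalEval]
    simp
  · simp [derivative_formalEval]
  · simp

/-- Each factor of the increment supplies one block of the composition. The increment has no
constant term, so all blocks are positive and the recursion on `n` removes the first one. -/
theorem coeff_taylorTerm_eq (Y : FormalPoint m) (n N : ℕ) (g : smoothFunctions m) :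
    coeff N (taylorTerm smoothPartial
        (formalEval smoothPartial (smoothEvalAt (Y 0)) fun i => C (Y 0 i))
        (fun i => PowerSeries.mk fun k => if k = 0 then 0 else Y k i) n g) =
      ∑ c : Composition N, if c.blocks.length = n then taylorListTerm (Y 0) Y g c.blocks else 0 := by
  induction n generalizing N g with
  | zero =>
    rw [taylorTerm, formalEval_C]
    cases N with
    | zero =>
      rw [Composition.sum_zero (fun l => if l.length = 0 then taylorListTerm (Y 0) Y g l else 0)]
      simp [taylorListTerm, smoothEvalAt_apply]
    | succ N =>
      rw [Composition.sum_blocks_succ N (fun l => if l.length = 0 then taylorListTerm (Y 0) Y g l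
        else 0)]
      simp
  | succ n ih =>
    rw [taylorTerm, coeff_smul, map_sum]
    simp only [coeff_mul, ih, coeff_mk]
    cases N with
    | zero =>
      rw [Composition.sum_zero (fun l => if l.length = n + 1 then taylorListTerm (Y 0) Y g l
        else 0)]
      simp
    | succ N =>
      rw [Composition.sum_blocks_succ N (fun l => if l.length = n + 1 then
        taylorListTerm (Y 0) Y g l else 0)]
      simp only [Finset.Nat.sum_antidiagonal_succ, if_true, zero_mul, zero_add,
        Nat.add_eq_zero_iff, one_ne_zero, and_false, if_false]
      rw [Finset.sum_comm, Finset.smul_sum]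
      refine Finset.sum_congr rfl fun x _ => ?_
      simp only [Finset.mul_sum]
      rw [Finset.sum_comm, Finset.smul_sum]
      refine Finset.sum_congr rfl fun c _ => ?_
      simp only [List.length_cons, Nat.add_right_cancel_iff, taylorListTerm_cons]
      split_ifs with h
      · rw [h, smul_eq_mul]
      · simp

/-- Identifies the evaluation defined by the chain rule with the one defined by Taylor series:
expand around the constant series `Y 0`, where evaluation gives constants. -/
theorem coeff_formalEval_smooth (Y : FormalPoint m) (g : smoothFunctions m) (N : ℕ) :
    coeff N (formalEval smoothPartial (smoothEvalAt (Y 0))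
      (fun i => PowerSeries.mk fun k => Y k i) g) =
    ∑ c : Composition N, (c.length.factorial : ℝ)⁻¹ *
      iteratedFDeriv ℝ c.length g.1 (Y 0) fun i => Y (c.blocksFun i) := by
  set V : Fin m → ℝ⟦X⟧ := fun i => PowerSeries.mk fun k => if k = 0 then 0 else Y k i with hV
  have hV0 : ∀ i, coeff 0 (V i) = 0 := fun i => by simp [hV]
  have hY : (fun i => PowerSeries.mk fun k => Y k i) = fun i => C (Y 0 i) + V i := by
    funext i
    rw [hV]
    ext k
    by_cases hk : k = 0
    · simp [hk]
    · simp [hk, coeff_C]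
  rw [hY, coeff_formalEval_add smoothPartial (smoothEvalAt (Y 0)) smoothPartial_comm
    (fun i => C (Y 0 i)) hV0 (le_refl N) g, map_sum]
  rw [Finset.sum_congr rfl fun n _ => coeff_taylorTerm_eq Y n N g, Finset.sum_comm]
  refine Finset.sum_congr rfl fun c _ => ?_
  rw [Finset.sum_ite_eq, if_pos]
  · rfl
  · have := c.length_le
    rw [Composition.length] at this
    simp only [Finset.mem_range]
    omega

theorem evalFormal_apply_eq (g : EuclideanSpace ℝ (Fin m) → EuclideanSpace ℝ (Fin m))
    (hg : ContDiff ℝ ∞ g) (Y : FormalPoint m) (N : ℕ) (i : Fin m) :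
    evalFormal g Y N i = coeff N (formalEval smoothPartial (smoothEvalAt (Y 0))
      (fun i => PowerSeries.mk fun k => Y k i) (smoothComponent g hg i)) := by
  rw [coeff_formalEval_smooth, evalFormal]
  simp [iteratedFDeriv_smoothComponent]

end SmoothFunctions

/-! ### The action of a character on `H` -/

section Convolution

variable {d : ℕ} {H : Type*} [CommRing H] [HopfAlgebra ℝ H]

/-- A character as a morphism of algebras. -/
noncomputable def IsCharacter.toAlgHom {Z : Module.Dual ℝ H} (hZ : IsCharacter Z) : H →ₐ[ℝ] ℝ :=
  AlgHom.ofLinearMap Z hZ.1 hZ.2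

/-- The action `(Z ⊗ id) ∘ Δ` of a character on a Hopf algebra. -/
noncomputable def IsCharacter.act {Z : Module.Dual ℝ H} (hZ : IsCharacter Z) : H →ₐ[ℝ] H :=
  (Algebra.TensorProduct.lid ℝ H).toAlgHom.comp
    ((Algebra.TensorProduct.map hZ.toAlgHom (AlgHom.id ℝ H)).comp (Bialgebra.comulAlgHom ℝ H))

theorem IsCharacter.act_apply {Z : Module.Dual ℝ H} (hZ : IsCharacter Z) (u : H) :
    hZ.act u = TensorProduct.lid ℝ H (TensorProduct.map Z LinearMap.id
      (Coalgebra.comul (R := ℝ) u)) := rfl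

/-- Apply `Z ⊗ id` to the cocycle condition: `id ⊗ L a` commutes with it, and the term `L a u ⊗ 1`
becomes a scalar. -/
theorem IsCharacter.act_cocycle {Z : Module.Dual ℝ H} (hZ : IsCharacter Z)
    {L : Fin d → H →ₗ[ℝ] H} (hL : IsCocycle L) (a : Fin d) (u : H) :
    hZ.act (L a u) = L a (hZ.act u) + algebraMap ℝ H (Z (L a u)) := by
  rw [hZ.act_apply, hZ.act_apply, hL, map_add, map_add, TensorProduct.map_tmul,
    TensorProduct.lid_tmul, LinearMap.id_apply, Algebra.algebraMap_eq_smul_one]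
  congr 1
  generalize Coalgebra.comul (R := ℝ) u = w
  induction w with
  | zero => simp
  | tmul x y => simp
  | add x y hx hy => simp only [map_add, hx, hy]

theorem IsCharacter.apply_act {Z₁ : Module.Dual ℝ H} (hZ₁ : IsCharacter Z₁) (Z₂ : Module.Dual ℝ H)
    (u : H) : Z₂ (hZ₁.act u) = dualStar Z₁ Z₂ u := by
  rw [hZ₁.act_apply, dualStar, LinearMap.comp_apply, LinearMap.comp_apply]
  generalize Coalgebra.comul (R := ℝ) u = w
  induction w with
  | zero => simp
  | tmul x y => simp
  | add x y hx hy => simp only [map_add, hx, hy]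

end Convolution

/-! ### B-series as images of the tree series -/

section BSeriesComposition

open PowerSeries

variable {d m : ℕ} {H : Type*} [CommRing H] [HopfAlgebra ℝ H]

theorem PTree.contDiff_elemDiff
    (f : Fin d → EuclideanSpace ℝ (Fin m) → EuclideanSpace ℝ (Fin m))
    (hf : ∀ a, ContDiff ℝ ∞ (f a)) (p : PTree d) : ContDiff ℝ ∞ (p.elemDiff f) := by
  rw [contDiff_euclidean]
  intro i
  simp only [PTree.elemDiff_eq_elemDiffAlg f hf]
  exact contDiff_of_smoothFunctions _

/-- The coefficients of a B-series are the values of the functional on the universal tree series. -/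
theorem bSeriesHopf_apply (L : Fin d → H →ₗ[ℝ] H)
    (f : Fin d → EuclideanSpace ℝ (Fin m) → EuclideanSpace ℝ (Fin m))
    (hf : ∀ a, ContDiff ℝ ∞ (f a)) (Y : FormalPoint m) (Z : Module.Dual ℝ H) {N K : ℕ}
    (hN : N ≤ K) (i : Fin m) :
    bSeriesHopf L f hf Y Z N i = Y N i + Z (coeff N (treeSeries smoothPartial (smoothEvalAt (Y 0)) L
      (fun a => smoothComponent (f a) (hf a)) (fun i => PowerSeries.mk fun k => Y k i) K i)) := by
  rw [bSeriesHopf, bSeriesTree, PiLp.add_apply]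
  congr 1
  set E := formalEval smoothPartial (smoothEvalAt (Y 0)) (fun i => PowerSeries.mk fun k => Y k i)
    with hE
  set U : PTree d → smoothFunctions m := fun p =>
    p.elemDiffAlg smoothPartial (fun a => smoothComponent (f a) (hf a)) i with hU
  -- Inverse symmetry factors are traded for weights of planar trees.
  have h1 : ∀ x ∈ Finset.HasAntidiagonal.antidiagonal N, ∑ t ∈ RTree.ofSize d x.1,
      (LamStar L Z (MvPolynomial.X t) / (t.symFactor : ℝ)) • evalFormal (t.elemDiff f hf) Y x.2 =
      ∑ p : {p : PTree d // p.size ≤ K}, if p.1.size = x.1 then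
        (p.1.weight * Z (p.1.toHopf L)) • evalFormal (p.1.elemDiff f) Y x.2 else 0 := by
    intro x hx
    have hx' := Finset.HasAntidiagonal.mem_antidiagonal.1 hx
    have := RTree.sum_ofSize_eq (show x.1 ≤ K by omega) fun t : RTree d =>
      LamStar L Z (MvPolynomial.X t) • evalFormal (t.elemDiff f hf) Y x.2
    simp only [smul_smul] at this
    simp only [div_eq_inv_mul, this]
    refine Finset.sum_congr rfl fun p _ => ?_
    have h2 : LamStar L Z (MvPolynomial.X (RTree.mk p.1)) = Z (p.1.toHopf L) := by
      simp only [LamStar, LinearMap.comp_apply, AlgHom.toLinearMap_apply, Lam,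
        MvPolynomial.aeval_X]
      rfl
    rw [h2]
    rfl
  have h3 : ∀ p : PTree d, ∀ q, evalFormal (p.elemDiff f) Y q i = coeff q (E (U p)) := by
    intro p q
    rw [evalFormal_apply_eq _ (p.contDiff_elemDiff f hf), hE]
    congr 2
    ext x
    exact p.elemDiff_eq_elemDiffAlg f hf x i
  rw [Finset.sum_congr rfl h1, treeSeries, map_sum, map_sum, Finset.sum_comm, WithLp.ofLp_sum,
    Finset.sum_apply]
  refine Finset.sum_congr rfl fun p _ => ?_
  rw [treeMonomial, coeff_monomial_mul_map_algebraMap, WithLp.ofLp_sum, Finset.sum_apply]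
  split_ifs with hp
  · rw [Finset.sum_eq_single (p.1.size, N - p.1.size)]
    · simp only [if_true, map_smul, PiLp.smul_apply, smul_eq_mul, h3]
      exact mul_comm _ _
    · rintro ⟨a, b⟩ hx hne
      have hx' := Finset.HasAntidiagonal.mem_antidiagonal.1 hx
      simp only at hx'
      rw [if_neg]
      · rfl
      · rintro rfl
        exact hne (Prod.ext rfl (by simp only; omega))
    · intro h
      exact absurd (Finset.HasAntidiagonal.mem_antidiagonal.2 (by simp only; omega)) h
  · rw [map_zero]
    refine Finset.sum_eq_zero fun x hx => ?_
    have hx' := Finset.HasAntidiagonal.mem_antidiagonal.1 hx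
    rw [if_neg (by omega)]
    rfl

end BSeriesComposition

theorem mainTheorem5 {d m : ℕ} {H : Type*} [CommRing H] [HopfAlgebra ℝ H]
    (L : Fin d → H →ₗ[ℝ] H) (hL : IsCocycle L)
    (f : Fin d → EuclideanSpace ℝ (Fin m) → EuclideanSpace ℝ (Fin m))
    (hf : ∀ a, ContDiff ℝ ∞ (f a))
    (Z₁ Z₂ : Module.Dual ℝ H) (hZ₁ : IsCharacter Z₁) (hZ₂ : Z₂ 1 = 1)
    (y : EuclideanSpace ℝ (Fin m)) :
    bSeriesHopf L f hf (bSeriesHopf L f hf (FormalPoint.const y) Z₁) Z₂ =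
      bSeriesHopf L f hf (FormalPoint.const y) (dualStar Z₁ Z₂) := by
  -- The inner B-series keeps the base point, so both tree series use the same evaluation
  -- `smoothEvalAt`, as `map_coeff_treeSeries` requires.
  have hY0 : bSeriesHopf L f hf (FormalPoint.const y) Z₁ 0 = FormalPoint.const y 0 := by
    ext i
    rw [bSeriesHopf_apply L f hf _ Z₁ le_rfl, coeff_zero_treeSeries, map_zero, add_zero]
  funext N
  ext i
  rw [bSeriesHopf_apply L f hf _ Z₂ (le_refl N),
    bSeriesHopf_apply L f hf _ (dualStar Z₁ Z₂) (le_refl N), hY0]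
  have key := map_coeff_treeSeries smoothPartial (smoothEvalAt (FormalPoint.const y 0))
    smoothPartial_comm L (fun a => smoothComponent (f a) (hf a)) hZ₁.act Z₁ (hZ₁.act_cocycle hL)
    (fun i => PowerSeries.mk fun k => FormalPoint.const y k i)
    (fun i => PowerSeries.mk fun k => bSeriesHopf L f hf (FormalPoint.const y) Z₁ k i) N
    (fun k hk i => by
      rw [PowerSeries.coeff_mk, PowerSeries.coeff_mk, bSeriesHopf_apply L f hf _ Z₁ hk])
    N le_rfl i
  -- `Z₂ 1 = 1` lets the base points pass through `Z₂` unchanged.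
  have h2 := congrArg Z₂ key
  rw [map_add, map_add, hZ₁.apply_act, PowerSeries.coeff_mk, PowerSeries.coeff_mk,
    Algebra.algebraMap_eq_smul_one, Algebra.algebraMap_eq_smul_one, map_smul, map_smul, hZ₂,
    smul_eq_mul, smul_eq_mul, mul_one, mul_one] at h2
  exact h2.symm
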